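/- Let $(\Omega,\mathcal A,(\mathcal F_t)_{t\ge 0},P)$ be a filtered probability space, $d\ge 1$, $c>0$, and let $\psi_{G,c}(\lambda)=\frac{\lambda^2}{2(1-c\lambda)}$ for $\lambda\in[0,1/c)$. Let $(S_t)_{t\ge0}$ in $\mathbb R^d$ and $(V_t)_{t\ge0}$ in the symmetric positive definite $d\times d$ matrices be adapted, and let $(S_t,V_t)$ be a sub-$\psi_{G,c}$ process: for every unit vector $\theta$ and every $\lambda\in[0,1/c)$ there is a nonnegative supermartingale $(L_t)$ with $\mathbb E L_0\le 1$ such that $\exp\{\lambda\langle\theta,S_t\rangle-\psi_{G,c}(\lambda)\langle\theta,V_t\theta\rangle\}\le L_t$ for all $t\ge0$. Let $U_0$ be a fixed symmetric positive definite matrix with smallest eigenvalue $\rho=\gamma_{\min}(U_0)$, and suppose that $V_t\succeq U_0$ for all $t\ge t_0$, where $t_0\ge 0$ is a fixed integer (usually $0$ or $1$). Put $$H_c(V)=\max\Big\{0,\ \sqrt{1-\tfrac{\gamma_{\max}(U_0)}{\gamma_{\min}(V)}}-\sqrt{\tfrac{\gamma_{\max}(U_0)}{\gamma_{\min}(V)}\cdot\tfrac{2}{c+\sqrt{c^2+2c}}}\Big\}$$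 if $\gamma_{\min}(V)\ge\gamma_{\max}(U_0)$, and $H_c(V)=0$ otherwise. Write $\|x\|_A=\sqrt{\langle x,Ax\rangle}$. The bounds below are read as vacuous (right-hand side $+\infty$) when $H_c(V_\tau)=0$. (Simplified form.) Suppose $U_0\succeq I_d$ and $\delta\in(0,1/\sqrt2]$. Then, with probability at least $1-\delta$, simultaneously for all stopping times $\tau$, whenever $t_0\le\tau<\infty$, $$\|S_\tau\|_{V_\tau^{-1}}\le\frac{cD_\tau+1.60\sqrt{D_\tau}+\max\big\{\frac{c+\sqrt{c^2+2\rho}}{2\rho},\sqrt{D_\tau/2}\big\}}{H_c(V_\tau)},$$ $$D_\tau=\tfrac12\log\frac{\det V_\tau}{\det U_0}+1.5+2\log(\log_2(\det V_\tau)+1)+\log(1/\delta).$$ (General form.) Suppose instead that $U_0$ is any symmetric positive definite matrix and that $V_t\succeq I_d$ for all $t\ge t_0$. Let $\ell:\{0,1,2,\dots\}\to(0,\infty)$ satisfy $\sum_{k\ge0}1/\ell(k)=1$ and $\sup_{k\ge0}\ell(k+2)/\ell(k+1)<\infty$, let $\delta\in(0,1)$ and $1<\eta<(e/\delta)^2$,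 and put $$\alpha_{\delta,\eta}=1+\frac{\log\eta}{1+\log(1/\delta)-\frac12\log\eta}+\sup_{k\ge0}\frac{\ell(k+2)}{\ell(k+1)}.$$ Then, with probability at least $1-\delta$, simultaneously for all stopping times $\tau$, whenever $t_0\le\tau<\infty$, $$\|S_\tau\|_{V_\tau^{-1}}\le\frac{cD_{\tau,\eta}+\sqrt{\frac{\alpha_{\delta,\eta}}2D_{\tau,\eta}}+\max\big\{\frac{c+\sqrt{c^2+2\rho}}{2\rho},\sqrt{D_{\tau,\eta}/2}\big\}}{H_c(V_\tau)},$$ $$D_{\tau,\eta}=\tfrac12\log\frac{\det V_\tau}{\det U_0}+1+\log\ell\big(\lfloor\log_\eta\det V_\tau\rfloor\big)+\log(1/\delta).$$ -/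

import Mathlib

open MeasureTheory Filter
open scoped ENNReal Matrix

noncomputable section

/-- The quadratic form `⟨x, A x⟩` on Euclidean space. -/
def quadForm {d : ℕ} (A : Matrix (Fin d) (Fin d) ℝ) (x : EuclideanSpace ℝ (Fin d)) : ℝ :=
  x.ofLp ⬝ᵥ (A *ᵥ x.ofLp)

/-- The weighted norm `‖x‖_A = √⟨x, A x⟩`. -/
def weightedNorm {d : ℕ} (A : Matrix (Fin d) (Fin d) ℝ) (x : EuclideanSpace ℝ (Fin d)) : ℝ :=
  Real.sqrt (quadForm A x)

/-- The Loewner order: `A ⪰ B` when `A - B` is positive semidefinite. -/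
def LoewnerGE {d : ℕ} (A B : Matrix (Fin d) (Fin d) ℝ) : Prop :=
  (A - B).PosSemidef

/-- Smallest eigenvalue of a real symmetric matrix. -/
def gammaMin {d : ℕ} (A : Matrix (Fin d) (Fin d) ℝ) : ℝ :=
  sInf (spectrum ℝ A)

/-- Largest eigenvalue of a real symmetric matrix. -/
def gammaMax {d : ℕ} (A : Matrix (Fin d) (Fin d) ℝ) : ℝ :=
  sSup (spectrum ℝ A)

/-- The sub-gamma function `ψ_{G,c}(lam) = lam² / (2 (1 - c lam))`; for `c > 0` its domain
is `[0, 1/c)`. -/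
def psiGamma (c lam : ℝ) : ℝ :=
  lam ^ 2 / (2 * (1 - c * lam))

/-- `(S, V)` is a sub-`ψ` process, where `I = [0, lam_max)` is the domain of `ψ`: both processes
are adapted, `V t` is (symmetric) positive definite, and for every unit vector `θ` and every
`lam ∈ I` the process `exp (lam ⟨θ, S t⟩ - ψ lam ⟨θ, V t θ⟩)` is dominated by a nonnegative
supermartingale `L` (depending on `lam` and `θ`) whose initial value has mean at most one. -/
structure IsSubPsi {Ω : Type*} [m : MeasurableSpace Ω] (μ : Measure Ω) (ℱ : Filtration ℕ m)
    {d : ℕ} (ψ : ℝ → ℝ) (I : Set ℝ) (S : ℕ → Ω → EuclideanSpace ℝ (Fin d))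
    (V : ℕ → Ω → Matrix (Fin d) (Fin d) ℝ) : Prop where
  adapted_S : StronglyAdapted ℱ S
  adapted_V : StronglyAdapted ℱ V
  posDef_V : ∀ t, ∀ᵐ ω ∂μ, (V t ω).PosDef
  dominated : ∀ θ : EuclideanSpace ℝ (Fin d), ‖θ‖ = 1 → ∀ lam ∈ I,
    ∃ L : ℕ → Ω → ℝ, Supermartingale L ℱ μ ∧ (∀ t, ∀ᵐ ω ∂μ, 0 ≤ L t ω) ∧
      ∫ ω, L 0 ω ∂μ ≤ 1 ∧
      ∀ t, ∀ᵐ ω ∂μ,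
        Real.exp (lam * inner ℝ θ (S t ω) - ψ lam * quadForm (V t ω) θ) ≤ L t ω

/-- A sub-gamma process with scale `c > 0`: a sub-`ψ_{G,c}` process on `[0, 1/c)`. -/
def IsSubGamma {Ω : Type*} [m : MeasurableSpace Ω] (μ : Measure Ω) (ℱ : Filtration ℕ m)
    {d : ℕ} (c : ℝ) (S : ℕ → Ω → EuclideanSpace ℝ (Fin d))
    (V : ℕ → Ω → Matrix (Fin d) (Fin d) ℝ) : Prop :=
  IsSubPsi μ ℱ (psiGamma c) (Set.Ico 0 (1 / c)) S V

/-- The factor `H_c(U, V)`. When `γ_max(U) > γ_min(V)` the first square root is that of a negative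
number, hence `0` here, and the factor is `0`. -/
def hFactor {d : ℕ} (c : ℝ) (U V : Matrix (Fin d) (Fin d) ℝ) : ℝ :=
  max 0 (Real.sqrt (1 - gammaMax U / gammaMin V) -
    Real.sqrt (gammaMax U / gammaMin V * (2 / (c + Real.sqrt (c ^ 2 + 2 * c)))))

/-- The term `max {(c + √(c² + 2ρ)) / (2ρ), √(D/2)}`. -/
def maxTerm (c ρ D : ℝ) : ℝ :=
  max ((c + Real.sqrt (c ^ 2 + 2 * ρ)) / (2 * ρ)) (Real.sqrt (D / 2))

/-- `D` for the choices `η = 2`, `ℓ(k) = (k+1)² π²/6`, with rounded constants. -/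
def DSimple {d : ℕ} (δ : ℝ) (U V : Matrix (Fin d) (Fin d) ℝ) : ℝ :=
  1 / 2 * Real.log (V.det / U.det) + 1.5 + 2 * Real.log (Real.logb 2 V.det + 1) +
    Real.log (1 / δ)

/-- `D` for a general epoch ratio `η` and stitching function `ℓ`, which is evaluated at the index
`k = ⌊log_η det V⌋` of the epoch `η ^ k ≤ det V < η ^ (k + 1)`. -/
def DGeneral {d : ℕ} (δ η : ℝ) (ell : ℕ → ℝ) (U V : Matrix (Fin d) (Fin d) ℝ) : ℝ :=
  1 / 2 * Real.log (V.det / U.det) + 1 + Real.log (ell ⌊Real.logb η V.det⌋₊) +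
    Real.log (1 / δ)

/-- The constant `α_{δ,η}`. -/
def alphaConst (δ η : ℝ) (ell : ℕ → ℝ) : ℝ :=
  1 + Real.log η / (1 + Real.log (1 / δ) - Real.log η / 2) + ⨆ k : ℕ, ell (k + 2) / ell (k + 1)

/-- With probability at least `1 - δ`, for all stopping times `τ`: whenever `t₀ ≤ τ < ∞` and the
denominator `H (V τ)` is nonzero, `‖S τ‖_{(V τ)⁻¹} ≤ N (V τ) / H (V τ)`. (If `H (V τ) = 0`, the
right-hand side is infinite.) -/
def StoppedBound {Ω : Type*} [m : MeasurableSpace Ω] (μ : Measure Ω) (ℱ : Filtration ℕ m)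
    {d : ℕ} (S : ℕ → Ω → EuclideanSpace ℝ (Fin d)) (V : ℕ → Ω → Matrix (Fin d) (Fin d) ℝ)
    (t₀ : ℕ) (δ : ℝ) (N H : Matrix (Fin d) (Fin d) ℝ → ℝ) : Prop :=
  ∃ A : Set Ω, MeasurableSet A ∧ ENNReal.ofReal (1 - δ) ≤ μ A ∧
    ∀ τ : Ω → WithTop ℕ, IsStoppingTime ℱ τ → ∀ ω ∈ A, ∀ t : ℕ, τ ω = t → t₀ ≤ t →
      H (V t ω) ≠ 0 →
        weightedNorm (V t ω)⁻¹ (S t ω) ≤ N (V t ω) / H (V t ω)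

end

/-! The proof is a method of mixtures. For fixed `u` with `‖u‖ < 1/c`, the weight `exp(⟨u,S⟩ -
⟨u,Vu⟩/(2(1-c‖u‖)))` is dominated by a nonnegative supermartingale of initial mean at most one.
Average it over `u` uniform on balls of radii `q k`, the `k`-th ball having mass `1/ell k`. Ville's
inequality (`IsSubGamma.measure_exists_le_lintegral_le`) keeps the average below `1/δ` at all times,
off an event of probability at most `δ`. Hence each single ball contributes at most `1/δ`, and all
stopping times are covered at once.

At a time with `η^k ≤ det V < η^(k+1)` only the ball `k` is used. On it the penalty is at most
`⟨u,Vu⟩/(2(1-cq))`, so the weight exceeds a Gaussian one. Restrict the integral to an ellipsoid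
`⟨u,Vu⟩ < Υ²` inside the ball and map it linearly to the unit ball. There the linear functional of
`u` has norm `Υ‖S‖_{V⁻¹}`, and the Jacobian produces `det V`. A boost of `[-1,1]` combined with the
tangent inequality for `exp` bounds the exponential moment on the unit ball below by
`exp(Yσ-1)(1-σ²)^((d+1)/2)` times its volume, where `Y` is that norm
(`exp_mul_le_integral_exp_mul_sqrt_pow`).

Taking logarithms bounds `‖S‖_{V⁻¹}` in terms of two free parameters: the ellipsoid size, written `Υ
= q√s K`, and `y = 1-σ²`. The constraint is `K² s ≤ γ_min(V)`. The rest is a deterministic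
optimisation (`exists_radius_multiplier`): suitable `K` and `y` give the numerator `cD + D/a + max`
over `H_c`, where `a²` is the lower value of `D` on the epoch. Finally `D/a` is absorbed into
`√(αD/2)`, since `D` varies by at most `log η / 2` above `a²`. -/

/-! ### Exponential moments of the uniform law on a ball -/

theorem hasDerivAt_sqrt_one_sub_sq_pow (n : ℕ) {t : ℝ} (ht : t ∈ Set.Ioo (-1 : ℝ) 1) :
    HasDerivAt (fun t : ℝ => Real.sqrt (1 - t ^ 2) ^ (n + 2))
      (-((n : ℝ) + 2) * (t * Real.sqrt (1 - t ^ 2) ^ n)) t := by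
  have hpos : 0 < 1 - t ^ 2 := by nlinarith [ht.1, ht.2]
  have h1 : HasDerivAt (fun t : ℝ => 1 - t ^ 2) (-(2 * t)) t := by
    simpa using ((hasDerivAt_pow 2 t).const_sub 1)
  have h2 := (h1.sqrt hpos.ne').pow (n + 2)
  have hs : Real.sqrt (1 - t ^ 2) ≠ 0 := (Real.sqrt_pos.2 hpos).ne'
  refine h2.congr_deriv ?_
  rw [show n + 2 - 1 = n + 1 from rfl]
  push_cast
  field_simp
  ring

theorem continuous_sqrt_one_sub_sq_pow (n : ℕ) :
    Continuous fun t : ℝ => Real.sqrt (1 - t ^ 2) ^ n := by fun_prop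

theorem integral_mul_sqrt_one_sub_sq_pow (n : ℕ) :
    ∫ t in (-1 : ℝ)..1, t * Real.sqrt (1 - t ^ 2) ^ n = 0 := by
  have h := intervalIntegral.integral_eq_sub_of_hasDerivAt_of_le (a := -1) (b := 1)
    (f := fun t : ℝ => Real.sqrt (1 - t ^ 2) ^ (n + 2)) (by norm_num)
    (continuous_sqrt_one_sub_sq_pow _).continuousOn
    (fun t ht => hasDerivAt_sqrt_one_sub_sq_pow n ht)
    (Continuous.intervalIntegrable (by fun_prop) _ _)
  rw [intervalIntegral.integral_const_mul] at h
  have hn : -((n : ℝ) + 2) ≠ 0 := by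
    have : (0 : ℝ) ≤ n := n.cast_nonneg
    linarith
  refine (mul_eq_zero.1 (h.trans ?_)).resolve_left hn
  norm_num

/-- Integrate the derivative of `t (1-t²)^((n+2)/2)`, which vanishes at both ends. This is the
second moment `1/(n+3)` of the beta density. -/
theorem integral_sq_mul_sqrt_one_sub_sq_pow (n : ℕ) :
    ((n : ℝ) + 3) * ∫ t in (-1 : ℝ)..1, t ^ 2 * Real.sqrt (1 - t ^ 2) ^ n =
      ∫ t in (-1 : ℝ)..1, Real.sqrt (1 - t ^ 2) ^ n := by
  have h := intervalIntegral.integral_eq_sub_of_hasDerivAt_of_le (a := -1) (b := 1)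
    (f := fun t : ℝ => t * Real.sqrt (1 - t ^ 2) ^ (n + 2))
    (f' := fun t : ℝ => Real.sqrt (1 - t ^ 2) ^ n -
      ((n : ℝ) + 3) * (t ^ 2 * Real.sqrt (1 - t ^ 2) ^ n)) (by norm_num)
    (by fun_prop)
    (fun t ht => by
      have hpos : 0 < 1 - t ^ 2 := by nlinarith [ht.1, ht.2]
      refine ((hasDerivAt_id t).mul (hasDerivAt_sqrt_one_sub_sq_pow n ht)).congr_deriv ?_
      have : Real.sqrt (1 - t ^ 2) ^ (n + 2) = Real.sqrt (1 - t ^ 2) ^ n * (1 - t ^ 2) := by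
        rw [pow_add, Real.sq_sqrt hpos.le]
      simp only [id, this]
      ring)
    (Continuous.intervalIntegrable (by fun_prop) _ _)
  rw [intervalIntegral.integral_sub (Continuous.intervalIntegrable (by fun_prop) _ _)
    (Continuous.intervalIntegrable (by fun_prop) _ _), intervalIntegral.integral_const_mul] at h
  norm_num at h
  linarith

/-- Substitution of the boost `s ↦ (s + σ) / (1 + σ s)` of `[-1, 1]`. -/
theorem integral_comp_boost (n : ℕ) (Y : ℝ) {σ : ℝ} (h0 : 0 ≤ σ) (h1 : σ < 1) :
    ∫ t in (-1 : ℝ)..1, Real.exp (Y * t) * Real.sqrt (1 - t ^ 2) ^ n =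
      ∫ s in (-1 : ℝ)..1, Real.exp (Y * ((s + σ) / (1 + σ * s))) *
        Real.sqrt (1 - ((s + σ) / (1 + σ * s)) ^ 2) ^ n * ((1 - σ ^ 2) / (1 + σ * s) ^ 2) := by
  have hpos : ∀ s ∈ Set.uIcc (-1 : ℝ) 1, 0 < 1 + σ * s := by
    intro s hs
    rw [Set.uIcc_of_le (by norm_num)] at hs
    nlinarith [hs.1, hs.2]
  have h := intervalIntegral.integral_comp_mul_deriv (a := -1) (b := 1)
    (f := fun s : ℝ => (s + σ) / (1 + σ * s)) (f' := fun s => (1 - σ ^ 2) / (1 + σ * s) ^ 2)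
    (g := fun t => Real.exp (Y * t) * Real.sqrt (1 - t ^ 2) ^ n)
    (fun s hs => by
      have hs' := (hpos s hs).ne'
      have h2 := ((hasDerivAt_id s).add_const σ).div
        (((hasDerivAt_id s).const_mul σ).const_add 1) hs'
      refine h2.congr_deriv ?_
      simp only [id]
      congr 1
      ring)
    (ContinuousOn.div continuousOn_const (by fun_prop)
      fun s hs => (pow_pos (hpos s hs) 2).ne') (by fun_prop)
  simp only [Function.comp_def] at h
  rw [h]
  congr 1
  · rw [eq_div_iff (by linarith)]
    ring
  · rw [eq_div_iff (by linarith)]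
    ring

/-- A lower bound for the exponential moment of a symmetric beta density, sharp up to a factor
that does not depend on `n`. -/
theorem exp_mul_le_integral_exp_mul_sqrt_pow (n : ℕ) (Y : ℝ) {σ : ℝ} (h0 : 0 ≤ σ) (h1 : σ < 1) :
    Real.exp (Y * σ - 1) * Real.sqrt (1 - σ ^ 2) ^ (n + 2) *
        ∫ t in (-1 : ℝ)..1, Real.sqrt (1 - t ^ 2) ^ n ≤
      ∫ t in (-1 : ℝ)..1, Real.exp (Y * t) * Real.sqrt (1 - t ^ 2) ^ n := by
  have hσ : 0 < 1 - σ ^ 2 := by nlinarith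
  have hpos : ∀ s ∈ Set.Icc (-1 : ℝ) 1, 0 < 1 + σ * s := by
    intro s hs
    nlinarith [hs.1, hs.2]
  rw [integral_comp_boost n Y h0 h1]
  -- The boosted integrand is `r^(n+2) (1+σs) exp(a) (1-s²)^(n/2)`, with `a` set below. Replacing
  -- `exp a` by its tangent at `m` and `log(1+σs)` by `σs` leaves a quadratic polynomial in `s`
  -- against the beta density.
  set m : ℝ := Y * σ - 1 with hm
  set r : ℝ := Real.sqrt (1 - σ ^ 2) with hr
  have key : ∀ s ∈ Set.Icc (-1 : ℝ) 1,
      Real.exp m * r ^ (n + 2) * (((1 + σ * s) * (1 - m) + Y * (s + σ) -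
        ((n : ℝ) + 3) * (σ * s + σ ^ 2 * s ^ 2)) * Real.sqrt (1 - s ^ 2) ^ n) ≤
      Real.exp (Y * ((s + σ) / (1 + σ * s))) *
        Real.sqrt (1 - ((s + σ) / (1 + σ * s)) ^ 2) ^ n * ((1 - σ ^ 2) / (1 + σ * s) ^ 2) := by
    intro s hs
    have hp := hpos s hs
    have hp' := hp.ne'
    have hs2 : 0 ≤ 1 - s ^ 2 := by nlinarith [hs.1, hs.2]
    have e1 : Real.sqrt (1 - ((s + σ) / (1 + σ * s)) ^ 2) =
        r * Real.sqrt (1 - s ^ 2) / (1 + σ * s) := by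
      have : 1 - ((s + σ) / (1 + σ * s)) ^ 2 = (1 - σ ^ 2) * (1 - s ^ 2) / (1 + σ * s) ^ 2 := by
        rw [div_pow, eq_div_iff (pow_ne_zero 2 hp'), sub_mul, div_mul_cancel₀ _ (pow_ne_zero 2 hp')]
        ring
      rw [this, Real.sqrt_div (by positivity), Real.sqrt_mul hσ.le, Real.sqrt_sq hp.le]
    have e2 : 1 - σ ^ 2 = r ^ 2 := (Real.sq_sqrt hσ.le).symm
    have hrn : 0 < r := Real.sqrt_pos.2 hσ
    rw [e1, e2, div_pow, mul_pow]
    set a : ℝ := Y * ((s + σ) / (1 + σ * s)) - ((n : ℝ) + 3) * Real.log (1 + σ * s) with ha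
    have e3 : Real.exp (Y * ((s + σ) / (1 + σ * s))) = Real.exp a * (1 + σ * s) ^ (n + 3) := by
      have : ((1 + σ * s) ^ (n + 3) : ℝ) = Real.exp (((n : ℝ) + 3) * Real.log (1 + σ * s)) := by
        rw [mul_comm ((n : ℝ) + 3), Real.exp_mul, Real.exp_log hp]
        exact_mod_cast (Real.rpow_natCast _ _).symm
      rw [this, ← Real.exp_add, ha]
      ring_nf
    have h3 : Real.exp m * (1 + a - m) ≤ Real.exp a := by
      have := Real.add_one_le_exp (a - m)
      calc Real.exp m * (1 + a - m) ≤ Real.exp m * Real.exp (a - m) := by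
            gcongr
            linarith
        _ = Real.exp a := by rw [← Real.exp_add]; ring_nf
    have h4 : Real.log (1 + σ * s) ≤ σ * s := by
      have := Real.log_le_sub_one_of_pos hp
      linarith
    have h5 : (1 + σ * s) * (1 - m) + Y * (s + σ) - ((n : ℝ) + 3) * (σ * s + σ ^ 2 * s ^ 2) ≤
        (1 + σ * s) * (1 + a - m) := by
      have : (1 + σ * s) * a = Y * (s + σ) - ((n : ℝ) + 3) * ((1 + σ * s) *
          Real.log (1 + σ * s)) := by
        rw [ha]
        field_simp
      have h6 : (1 + σ * s) * Real.log (1 + σ * s) ≤ (1 + σ * s) * (σ * s) := by gcongr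
      have h7 : ((n : ℝ) + 3) * ((1 + σ * s) * Real.log (1 + σ * s)) ≤
        ((n : ℝ) + 3) * ((1 + σ * s) * (σ * s)) := by gcongr
      nlinarith
    have hfinal : Real.exp a * (1 + σ * s) ^ (n + 3) *
        (r ^ n * Real.sqrt (1 - s ^ 2) ^ n / (1 + σ * s) ^ n) * (r ^ 2 / (1 + σ * s) ^ 2) =
        r ^ (n + 2) * ((1 + σ * s) * Real.exp a * Real.sqrt (1 - s ^ 2) ^ n) := by
      field_simp
      ring
    rw [e3, hfinal]
    calc _ ≤ Real.exp m * r ^ (n + 2) * ((1 + σ * s) * (1 + a - m) *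
          Real.sqrt (1 - s ^ 2) ^ n) := by gcongr
      _ = r ^ (n + 2) * ((1 + σ * s) * (Real.exp m * (1 + a - m)) *
          Real.sqrt (1 - s ^ 2) ^ n) := by ring
      _ ≤ _ := by gcongr
  refine le_trans ?_ (intervalIntegral.integral_mono_on (a := -1) (b := 1)
    (by norm_num) (Continuous.intervalIntegrable (by fun_prop) _ _) ?_ key)
  · rw [intervalIntegral.integral_const_mul]
    -- The odd moment vanishes and the second moment cancels the factor `n+3`, so the coefficient of
    -- the remaining integral is `1 - m + Yσ - σ² = 2 - σ² ≥ 1`. This is why the loss does not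
    -- depend on `n`.
    have hsplit : ∫ s in (-1 : ℝ)..1, (((1 + σ * s) * (1 - m) + Y * (s + σ) -
        ((n : ℝ) + 3) * (σ * s + σ ^ 2 * s ^ 2)) * Real.sqrt (1 - s ^ 2) ^ n) =
        (1 - m + Y * σ) * (∫ s in (-1 : ℝ)..1, Real.sqrt (1 - s ^ 2) ^ n) +
        (σ * (1 - m) + Y - ((n : ℝ) + 3) * σ) *
          (∫ s in (-1 : ℝ)..1, s * Real.sqrt (1 - s ^ 2) ^ n) -
        σ ^ 2 * (((n : ℝ) + 3) * ∫ s in (-1 : ℝ)..1, s ^ 2 * Real.sqrt (1 - s ^ 2) ^ n) := by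
      rw [← mul_assoc (σ ^ 2), ← intervalIntegral.integral_const_mul,
        ← intervalIntegral.integral_const_mul, ← intervalIntegral.integral_const_mul,
        ← intervalIntegral.integral_add, ← intervalIntegral.integral_sub]
      · congr 1
        ext s
        ring
      all_goals exact Continuous.intervalIntegrable (by fun_prop) _ _
    rw [hsplit, integral_mul_sqrt_one_sub_sq_pow, integral_sq_mul_sqrt_one_sub_sq_pow]
    have hC : 0 ≤ ∫ s in (-1 : ℝ)..1, Real.sqrt (1 - s ^ 2) ^ n :=
      intervalIntegral.integral_nonneg (by norm_num) fun s _ => by positivity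
    have hE : 0 ≤ Real.exp m * r ^ (n + 2) := by positivity
    refine mul_le_mul_of_nonneg_left ?_ hE
    rw [hm]
    nlinarith
  · refine ContinuousOn.intervalIntegrable ?_
    rw [Set.uIcc_of_le (by norm_num)]
    have hc : ContinuousOn (fun s : ℝ => (s + σ) / (1 + σ * s)) (Set.Icc (-1) 1) :=
      ContinuousOn.div (by fun_prop) (by fun_prop) fun s hs => (hpos s hs).ne'
    have hc2 : ContinuousOn (fun s : ℝ => (1 - σ ^ 2) / (1 + σ * s) ^ 2) (Set.Icc (-1) 1) :=
      ContinuousOn.div (by fun_prop) (by fun_prop) fun s hs => (pow_pos (hpos s hs) 2).ne'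
    fun_prop

/-- Splitting off the zeroth coordinate of Euclidean space. -/
theorem measurePreserving_euclidean_split (n : ℕ) :
    MeasurePreserving (fun z : EuclideanSpace ℝ (Fin (n + 1)) =>
      (z 0, (WithLp.toLp 2 fun j : Fin n => z j.succ : EuclideanSpace ℝ (Fin n)))) := by
  have h1 := PiLp.volume_preserving_ofLp (Fin (n + 1))
  have h2 := volume_preserving_piFinSuccAbove (fun _ : Fin (n + 1) => ℝ) 0
  have h3 := (MeasurePreserving.id (volume : Measure ℝ)).prod (PiLp.volume_preserving_toLp (Fin n))
  have := (h3.comp h2).comp h1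
  exact this

theorem lintegral_ball_comp_coord (n : ℕ) {f : ℝ → ℝ≥0∞} (hf : Measurable f) :
    ∫⁻ z in Metric.ball (0 : EuclideanSpace ℝ (Fin (n + 1))) 1, f (z 0) =
      volume (Metric.ball (0 : EuclideanSpace ℝ (Fin n)) 1) *
        ∫⁻ t in Set.Ioo (-1 : ℝ) 1, f t * ENNReal.ofReal (Real.sqrt (1 - t ^ 2) ^ n) := by
  set B : Set (ℝ × EuclideanSpace ℝ (Fin n)) := {p | p.1 ^ 2 + ‖p.2‖ ^ 2 < 1} with hB
  have hBm : MeasurableSet B :=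
    measurableSet_lt (by fun_prop) measurable_const
  have hg : Measurable (B.indicator fun p => f p.1) :=
    (hf.comp measurable_fst).indicator hBm
  have h1 := (measurePreserving_euclidean_split n).lintegral_comp hg
  have h2 : ∀ z : EuclideanSpace ℝ (Fin (n + 1)),
      (Metric.ball (0 : EuclideanSpace ℝ (Fin (n + 1))) 1).indicator (fun z => f (z 0)) z =
      B.indicator (fun p => f p.1)
        (z 0, (WithLp.toLp 2 fun j : Fin n => z j.succ : EuclideanSpace ℝ (Fin n))) := by
    intro z
    have : z ∈ Metric.ball (0 : EuclideanSpace ℝ (Fin (n + 1))) 1 ↔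
        (z 0, (WithLp.toLp 2 fun j : Fin n => z j.succ : EuclideanSpace ℝ (Fin n))) ∈ B := by
      rw [mem_ball_zero_iff, hB, Set.mem_ofPred_eq, ← sq_lt_one_iff₀ (norm_nonneg z),
        EuclideanSpace.norm_sq_eq, EuclideanSpace.norm_sq_eq, Fin.sum_univ_succ]
      simp [sq_abs]
    by_cases hz : z ∈ Metric.ball (0 : EuclideanSpace ℝ (Fin (n + 1))) 1
    · rw [Set.indicator_of_mem hz, Set.indicator_of_mem (this.1 hz)]
    · rw [Set.indicator_of_notMem hz, Set.indicator_of_notMem (fun h => hz (this.2 h))]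
  rw [← lintegral_indicator Metric.isOpen_ball.measurableSet, lintegral_congr h2, h1,
    Measure.volume_eq_prod, lintegral_prod _ hg.aemeasurable,
    ← lintegral_const_mul _ (by fun_prop), ← lintegral_indicator measurableSet_Ioo]
  refine lintegral_congr fun t => ?_
  have h3 : ∀ y : EuclideanSpace ℝ (Fin n), B.indicator (fun p => f p.1) (t, y) =
      {y : EuclideanSpace ℝ (Fin n) | t ^ 2 + ‖y‖ ^ 2 < 1}.indicator (fun _ => f t) y := fun y => rfl
  rw [lintegral_congr h3, lintegral_indicator_const (measurableSet_lt (by fun_prop)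
    measurable_const)]
  by_cases ht : t ∈ Set.Ioo (-1 : ℝ) 1
  · have hpos : 0 < 1 - t ^ 2 := by nlinarith [ht.1, ht.2]
    have h4 : {y : EuclideanSpace ℝ (Fin n) | t ^ 2 + ‖y‖ ^ 2 < 1} =
        Metric.ball 0 (Real.sqrt (1 - t ^ 2)) := by
      ext y
      rw [Set.mem_ofPred_eq, mem_ball_zero_iff, Real.lt_sqrt (norm_nonneg y)]
      constructor <;> intro h <;> linarith
    rw [Set.indicator_of_mem ht, h4, Measure.addHaar_ball_of_pos _ _ (Real.sqrt_pos.2 hpos),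
      finrank_euclideanSpace_fin]
    ring
  · have h4 : {y : EuclideanSpace ℝ (Fin n) | t ^ 2 + ‖y‖ ^ 2 < 1} = ∅ := by
      ext y
      simp only [Set.mem_ofPred_eq, Set.mem_empty_iff_false, iff_false, not_lt]
      have : 1 ≤ t ^ 2 := by
        by_contra h
        exact ht ⟨by nlinarith, by nlinarith⟩
      nlinarith [sq_nonneg ‖y‖]
    rw [Set.indicator_of_notMem ht, h4, measure_empty, mul_zero]

theorem lintegral_Ioo_ofReal {f : ℝ → ℝ} (hf : Continuous f) (h0 : ∀ t, 0 ≤ f t) :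
    ∫⁻ t in Set.Ioo (-1 : ℝ) 1, ENNReal.ofReal (f t) =
      ENNReal.ofReal (∫ t in (-1 : ℝ)..1, f t) := by
  rw [intervalIntegral.integral_of_le (by norm_num), integral_Ioc_eq_integral_Ioo,
    ofReal_integral_eq_lintegral_ofReal]
  · exact (hf.integrableOn_Icc).mono_set Set.Ioo_subset_Icc_self
  · exact Eventually.of_forall h0

/-- Exponential moments of a coordinate of a uniform point of the unit ball. -/
theorem exp_mul_volume_ball_le_lintegral_coord (n : ℕ) (Y : ℝ) {σ : ℝ} (h0 : 0 ≤ σ)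
    (h1 : σ < 1) :
    ENNReal.ofReal (Real.exp (Y * σ - 1) * Real.sqrt (1 - σ ^ 2) ^ (n + 2)) *
        volume (Metric.ball (0 : EuclideanSpace ℝ (Fin (n + 1))) 1) ≤
      ∫⁻ z in Metric.ball (0 : EuclideanSpace ℝ (Fin (n + 1))) 1,
        ENNReal.ofReal (Real.exp (Y * z 0)) := by
  have e1 := lintegral_ball_comp_coord n (f := fun _ => 1) measurable_const
  have e2 := lintegral_ball_comp_coord n (f := fun t => ENNReal.ofReal (Real.exp (Y * t)))
    (by fun_prop)
  rw [setLIntegral_one] at e1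
  simp only [one_mul] at e1
  rw [e1, e2, lintegral_Ioo_ofReal (by fun_prop) (fun t => by positivity)]
  have e3 : ∀ t : ℝ, ENNReal.ofReal (Real.exp (Y * t)) * ENNReal.ofReal (Real.sqrt (1 - t ^ 2) ^ n)
      = ENNReal.ofReal (Real.exp (Y * t) * Real.sqrt (1 - t ^ 2) ^ n) := fun t =>
    (ENNReal.ofReal_mul (Real.exp_nonneg _)).symm
  simp only [e3]
  rw [lintegral_Ioo_ofReal (by fun_prop) (fun t => by positivity), mul_left_comm,
    ← ENNReal.ofReal_mul (by positivity)]
  gcongr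
  exact exp_mul_le_integral_exp_mul_sqrt_pow n Y h0 h1

/-- Exponential moments of a linear functional of a uniform point of the unit ball. -/
theorem exp_mul_volume_ball_le_lintegral_inner {d : ℕ} (hd : 0 < d)
    (p : EuclideanSpace ℝ (Fin d)) {σ : ℝ} (h0 : 0 ≤ σ) (h1 : σ < 1) :
    ENNReal.ofReal (Real.exp (‖p‖ * σ - 1) * Real.sqrt (1 - σ ^ 2) ^ (d + 1)) *
        volume (Metric.ball (0 : EuclideanSpace ℝ (Fin d)) 1) ≤
      ∫⁻ z in Metric.ball (0 : EuclideanSpace ℝ (Fin d)) 1,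
        ENNReal.ofReal (Real.exp (inner ℝ z p)) := by
  obtain ⟨n, rfl⟩ : ∃ n, d = n + 1 := ⟨d - 1, by omega⟩
  set w : EuclideanSpace ℝ (Fin (n + 1)) := EuclideanSpace.single 0 ‖p‖ with hw
  have hnorm : ‖p‖ = ‖w‖ := by simp [hw]
  -- By rotation invariance of the ball, `p` may be moved to a multiple of the first basis vector; a
  -- reflection does it.
  set R := (ℝ ∙ (p - w))ᗮ.reflection with hR
  have hRp : R p = w := Submodule.reflection_sub hnorm
  have hmp := R.measurePreserving
  refine (exp_mul_volume_ball_le_lintegral_coord n ‖p‖ h0 h1).trans (le_of_eq ?_)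
  rw [← hmp.setLIntegral_comp_preimage Metric.isOpen_ball.measurableSet (by fun_prop)]
  have hpre : R ⁻¹' Metric.ball 0 1 = Metric.ball (0 : EuclideanSpace ℝ (Fin (n + 1))) 1 := by
    ext z
    simp
  rw [hpre]
  refine lintegral_congr fun z => ?_
  rw [← R.inner_map_map, hRp, hw, EuclideanSpace.inner_single_right]
  simp
-- Change of variables from the ellipsoid to the unit ball
open scoped MatrixOrder in
theorem Matrix.PosDef.exists_mul_transpose_eq_inv {d : ℕ} {V : Matrix (Fin d) (Fin d) ℝ}
    (hV : V.PosDef) : ∃ B : Matrix (Fin d) (Fin d) ℝ,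
      B * Bᵀ = V⁻¹ ∧ Bᵀ * V * B = 1 ∧ |B.det| = 1 / Real.sqrt V.det := by
  have hsemi : 0 ≤ V⁻¹ := Matrix.nonneg_iff_posSemidef.2 hV.inv.posSemidef
  set B := CFC.sqrt V⁻¹ with hB
  have hBB : B * B = V⁻¹ := CFC.sqrt_mul_sqrt_self _ hsemi
  have hBt : Bᵀ = B := by
    have : B.PosSemidef := Matrix.nonneg_iff_posSemidef.1 (CFC.sqrt_nonneg _)
    simpa [Matrix.conjTranspose_eq_transpose_of_trivial] using this.1.eq
  have hdet : B.det * B.det = (V.det)⁻¹ := by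
    rw [← Matrix.det_mul, hBB, Matrix.det_nonsing_inv, Ring.inverse_eq_inv]
  have hVdet := hV.det_pos
  have hBdet : IsUnit B.det := by
    rw [isUnit_iff_ne_zero]
    intro h0
    rw [h0, mul_zero] at hdet
    exact (inv_ne_zero hVdet.ne') hdet.symm
  refine ⟨B, by rw [hBt, hBB], ?_, ?_⟩
  · have h1 : V * (B * B) = 1 := by rw [hBB, Matrix.mul_nonsing_inv _ hVdet.ne'.isUnit]
    rw [hBt]
    have h2 : V * B = B⁻¹ := by
      calc V * B = V * (B * B) * B⁻¹ := by
            rw [Matrix.mul_assoc V (B * B), Matrix.mul_assoc B B, Matrix.mul_nonsing_inv _ hBdet,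
              Matrix.mul_one]
        _ = B⁻¹ := by rw [h1, Matrix.one_mul]
    rw [mul_assoc, h2, Matrix.mul_nonsing_inv _ hBdet]
  · rw [one_div, ← Real.sqrt_inv, ← hdet, Real.sqrt_mul_self_eq_abs]

/-- A lower bound for the integral of a Gaussian-type weight over a ball that contains the
ellipsoid `⟨u, V u⟩ < Υ²`. -/
theorem ellipsoid_mul_volume_le_lintegral_ball {d : ℕ} (hd : 0 < d)
    {V : Matrix (Fin d) (Fin d) ℝ} (hV : V.PosDef) (S : EuclideanSpace ℝ (Fin d))
    {q Υ κ σ : ℝ} (hΥ : 0 < Υ) (hκ : 0 ≤ κ)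
    (hincl : ∀ u : EuclideanSpace ℝ (Fin d), quadForm V u < Υ ^ 2 → ‖u‖ < q)
    (h0 : 0 ≤ σ) (h1 : σ < 1) :
    ENNReal.ofReal (Υ ^ d / Real.sqrt V.det * (Real.exp (-(κ * Υ ^ 2)) *
        (Real.exp (Υ * weightedNorm V⁻¹ S * σ - 1) * Real.sqrt (1 - σ ^ 2) ^ (d + 1)))) *
        volume (Metric.ball (0 : EuclideanSpace ℝ (Fin d)) 1) ≤
      ∫⁻ u in Metric.ball (0 : EuclideanSpace ℝ (Fin d)) q,
        ENNReal.ofReal (Real.exp (inner ℝ u S - κ * quadForm V u)) := by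
  obtain ⟨B, hB1, hB2, hB3⟩ := hV.exists_mul_transpose_eq_inv
  have hVdet := hV.det_pos
  have hdetB : B.det ≠ 0 := by
    rw [← abs_pos, hB3]
    positivity
  set L : EuclideanSpace ℝ (Fin d) →ₗ[ℝ] EuclideanSpace ℝ (Fin d) :=
    Υ • Matrix.toEuclideanLin B with hL
  have hLdet : LinearMap.det L = Υ ^ d * B.det := by
    rw [hL, LinearMap.det_smul, finrank_euclideanSpace_fin]
    congr 1
    exact LinearMap.det_toLpLin 2 B
  have hLne : LinearMap.det L ≠ 0 := by
    rw [hLdet]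
    positivity
  have hLof : ∀ z, (L z).ofLp = Υ • (B *ᵥ z.ofLp) := fun z => rfl
  have hQ : ∀ z, quadForm V (L z) = Υ ^ 2 * ‖z‖ ^ 2 := by
    intro z
    have : (B *ᵥ z.ofLp) ⬝ᵥ (V *ᵥ (B *ᵥ z.ofLp)) = z.ofLp ⬝ᵥ z.ofLp := by
      rw [Matrix.mulVec_mulVec, Matrix.dotProduct_mulVec, Matrix.vecMul_mulVec,
        ← Matrix.dotProduct_mulVec, ← Matrix.mul_assoc, hB2, Matrix.one_mulVec]
    rw [quadForm, hLof, Matrix.mulVec_smul, smul_dotProduct, dotProduct_smul, this,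
      EuclideanSpace.norm_sq_eq]
    simp only [dotProduct, smul_eq_mul, Real.norm_eq_abs, sq_abs]
    rw [← mul_assoc, ← sq]
    congr 1
    exact Finset.sum_congr rfl fun i _ => (sq _).symm
  set p : EuclideanSpace ℝ (Fin d) := Υ • WithLp.toLp 2 (Bᵀ *ᵥ S.ofLp) with hp
  have hin : ∀ z, inner ℝ (L z) S = inner ℝ z p := by
    intro z
    rw [EuclideanSpace.inner_eq_star_dotProduct, EuclideanSpace.inner_eq_star_dotProduct]
    simp only [hp, hLof, star_trivial, WithLp.ofLp_smul, smul_dotProduct, dotProduct_smul]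
    congr 1
    rw [Matrix.mulVec_transpose, ← Matrix.dotProduct_mulVec]
  have hpn : ‖p‖ = Υ * weightedNorm V⁻¹ S := by
    rw [hp, norm_smul, Real.norm_of_nonneg hΥ.le, weightedNorm, EuclideanSpace.norm_eq]
    congr 2
    rw [quadForm, ← hB1, ← Matrix.mulVec_mulVec, Matrix.dotProduct_mulVec,
      ← Matrix.mulVec_transpose]
    simp only [dotProduct, Real.norm_eq_abs, sq_abs]
    exact Finset.sum_congr rfl fun i _ => sq _
  set E : Set (EuclideanSpace ℝ (Fin d)) := {u | quadForm V u < Υ ^ 2} with hE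
  have hcont : Continuous fun u : EuclideanSpace ℝ (Fin d) => quadForm V u := by
    unfold quadForm
    fun_prop
  have hEm : MeasurableSet E := (isOpen_lt hcont continuous_const).measurableSet
  set F : EuclideanSpace ℝ (Fin d) → ℝ≥0∞ := fun u =>
    ENNReal.ofReal (Real.exp (inner ℝ u S - κ * quadForm V u)) with hF
  have hFm : Measurable F := by fun_prop
  have hLm : Measurable L := L.continuous_of_finiteDimensional.measurable
  have hmap : ∫⁻ z, E.indicator F (L z) =
      ENNReal.ofReal |(LinearMap.det L)⁻¹| * ∫⁻ u, E.indicator F u := by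
    rw [← lintegral_map (hFm.indicator hEm) hLm,
      Measure.map_linearMap_addHaar_eq_smul_addHaar _ hLne, lintegral_smul_measure, smul_eq_mul]
  have hind : ∀ z, E.indicator F (L z) =
      (Metric.ball (0 : EuclideanSpace ℝ (Fin d)) 1).indicator (fun z => F (L z)) z := by
    intro z
    have : L z ∈ E ↔ z ∈ Metric.ball (0 : EuclideanSpace ℝ (Fin d)) 1 := by
      rw [hE, Set.mem_ofPred_eq, hQ, mem_ball_zero_iff, ← sq_lt_one_iff₀ (norm_nonneg z)]
      have : 0 < Υ ^ 2 := by positivity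
      constructor
      · intro h
        by_contra h'
        nlinarith
      · intro h
        nlinarith
    by_cases hz : z ∈ Metric.ball (0 : EuclideanSpace ℝ (Fin d)) 1
    · rw [Set.indicator_of_mem hz, Set.indicator_of_mem (this.2 hz)]
    · rw [Set.indicator_of_notMem hz, Set.indicator_of_notMem (fun h => hz (this.1 h))]
  have hlow : ENNReal.ofReal (Real.exp (-(κ * Υ ^ 2)) *
        (Real.exp (Υ * weightedNorm V⁻¹ S * σ - 1) * Real.sqrt (1 - σ ^ 2) ^ (d + 1))) *
        volume (Metric.ball (0 : EuclideanSpace ℝ (Fin d)) 1) ≤ ∫⁻ z, E.indicator F (L z) := by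
    rw [lintegral_congr hind, lintegral_indicator Metric.isOpen_ball.measurableSet,
      ENNReal.ofReal_mul (Real.exp_nonneg _), mul_assoc, ← hpn]
    calc _ ≤ ENNReal.ofReal (Real.exp (-(κ * Υ ^ 2))) *
          ∫⁻ z in Metric.ball (0 : EuclideanSpace ℝ (Fin d)) 1,
            ENNReal.ofReal (Real.exp (inner ℝ z p)) := by
          gcongr
          exact exp_mul_volume_ball_le_lintegral_inner hd p h0 h1
      _ = ∫⁻ z in Metric.ball (0 : EuclideanSpace ℝ (Fin d)) 1,
            ENNReal.ofReal (Real.exp (-(κ * Υ ^ 2))) * ENNReal.ofReal (Real.exp (inner ℝ z p)) :=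
          (lintegral_const_mul _ (by fun_prop)).symm
      _ ≤ _ := by
          refine setLIntegral_mono' Metric.isOpen_ball.measurableSet fun z hz => ?_
          rw [hF, ← ENNReal.ofReal_mul (Real.exp_nonneg _), ← Real.exp_add]
          refine ENNReal.ofReal_le_ofReal (Real.exp_le_exp.2 ?_)
          rw [hin, hQ]
          rw [mem_ball_zero_iff] at hz
          have : ‖z‖ ^ 2 ≤ 1 := by nlinarith [norm_nonneg z]
          have h2 : κ * (Υ ^ 2 * ‖z‖ ^ 2) ≤ κ * Υ ^ 2 := by
            have : 0 ≤ κ * Υ ^ 2 := by positivity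
            nlinarith
          linarith
  have hup : ∫⁻ u, E.indicator F u ≤ ∫⁻ u in Metric.ball (0 : EuclideanSpace ℝ (Fin d)) q, F u := by
    rw [lintegral_indicator hEm]
    exact lintegral_mono_set fun u hu => mem_ball_zero_iff.2 (hincl u hu)
  have habs : Υ ^ d / Real.sqrt V.det = |LinearMap.det L| := by
    rw [hLdet, abs_mul, hB3, abs_of_pos (by positivity)]
    ring
  refine le_trans ?_ hup
  rw [ENNReal.ofReal_mul (by positivity), mul_assoc, habs]
  calc _ ≤ ENNReal.ofReal |LinearMap.det L| * ∫⁻ z, E.indicator F (L z) := by gcongr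
    _ = _ := by
      rw [hmap, ← mul_assoc, ← ENNReal.ofReal_mul (abs_nonneg _), ← abs_mul,
        mul_inv_cancel₀ hLne]
      simp

/-! ### Exponential weights and Ville's inequality for mixtures -/

/-- The exponential weight of a sub-gamma process in the direction `u`. -/
noncomputable def subGammaWeight {d : ℕ} (c : ℝ) (x : EuclideanSpace ℝ (Fin d)) (A : Matrix (Fin d) (Fin d) ℝ)
    (u : EuclideanSpace ℝ (Fin d)) : ℝ :=
  Real.exp (inner ℝ u x - quadForm A u / (2 * (1 - c * ‖u‖)))

theorem measurable_subGammaWeight {Ω : Type*} [MeasurableSpace Ω] {d : ℕ} (c : ℝ)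
    {S : Ω → EuclideanSpace ℝ (Fin d)} {V : Ω → Matrix (Fin d) (Fin d) ℝ}
    (hS : StronglyMeasurable S) (hV : StronglyMeasurable V) :
    Measurable fun p : Ω × EuclideanSpace ℝ (Fin d) =>
      ENNReal.ofReal (subGammaWeight c (S p.1) (V p.1) p.2) := by
  have hS' := hS.measurable
  have hV' : ∀ i j, Measurable fun ω => V ω i j := fun i j =>
    (Continuous.comp_stronglyMeasurable (g := fun A : Matrix (Fin d) (Fin d) ℝ => A i j)
      (by fun_prop) hV).measurable
  have hQ : Measurable fun p : Ω × EuclideanSpace ℝ (Fin d) => quadForm (V p.1) p.2 := by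
    unfold quadForm
    simp only [dotProduct, Matrix.mulVec]
    refine Finset.measurable_sum _ fun i _ => Measurable.mul (by fun_prop) ?_
    exact Finset.measurable_sum _ fun j _ =>
      ((hV' i j).comp measurable_fst).mul (by fun_prop)
  unfold subGammaWeight
  fun_prop

theorem measurableSet_le_lintegral_subGammaWeight {Ω : Type*} [MeasurableSpace Ω] {d : ℕ} {c : ℝ}
    {S : Ω → EuclideanSpace ℝ (Fin d)} {V : Ω → Matrix (Fin d) (Fin d) ℝ}
    (hS : StronglyMeasurable S) (hV : StronglyMeasurable V)
    (ν : Measure (EuclideanSpace ℝ (Fin d))) [SFinite ν] (a : ℝ≥0∞) :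
    MeasurableSet {ω | a ≤ ∫⁻ u, ENNReal.ofReal (subGammaWeight c (S ω) (V ω) u) ∂ν} :=
  measurableSet_le measurable_const (measurable_subGammaWeight c hS hV).lintegral_prod_right'

theorem quadForm_smul {d : ℕ} (A : Matrix (Fin d) (Fin d) ℝ) (a : ℝ)
    (x : EuclideanSpace ℝ (Fin d)) : quadForm A (a • x) = a ^ 2 * quadForm A x := by
  simp only [quadForm, WithLp.ofLp_smul, Matrix.mulVec_smul, smul_dotProduct, dotProduct_smul,
    smul_eq_mul]
  ring

theorem IsSubGamma.exists_supermartingale {Ω : Type*} [m : MeasurableSpace Ω] {μ : Measure Ω}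
    {ℱ : Filtration ℕ m} {d : ℕ} {c : ℝ} {S : ℕ → Ω → EuclideanSpace ℝ (Fin d)}
    {V : ℕ → Ω → Matrix (Fin d) (Fin d) ℝ} (hSV : IsSubGamma μ ℱ c S V) (hd : 0 < d)
    {u : EuclideanSpace ℝ (Fin d)} (hu : ‖u‖ < 1 / c) :
    ∃ L : ℕ → Ω → ℝ, Supermartingale L ℱ μ ∧ (∀ t, ∀ᵐ ω ∂μ, 0 ≤ L t ω) ∧
      ∫ ω, L 0 ω ∂μ ≤ 1 ∧
      ∀ t, ∀ᵐ ω ∂μ, subGammaWeight c (S t ω) (V t ω) u ≤ L t ω := by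
  obtain ⟨θ, hθ, hθu⟩ : ∃ θ : EuclideanSpace ℝ (Fin d), ‖θ‖ = 1 ∧ u = ‖u‖ • θ := by
    by_cases h : u = 0
    · refine ⟨EuclideanSpace.single ⟨0, hd⟩ 1, by simp, by simp [h]⟩
    · have : ‖u‖ ≠ 0 := norm_ne_zero_iff.2 h
      refine ⟨‖u‖⁻¹ • u, by simp [norm_smul, this], by simp [smul_smul, this]⟩
  obtain ⟨L, h1, h2, h3, h4⟩ := hSV.dominated θ hθ ‖u‖ ⟨norm_nonneg u, hu⟩
  refine ⟨L, h1, h2, h3, fun t => ?_⟩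
  filter_upwards [h4 t] with ω hω
  convert hω using 2
  have e1 : inner ℝ u (S t ω) = ‖u‖ * inner ℝ θ (S t ω) := by
    conv_lhs => rw [hθu, real_inner_smul_left]
  have e2 : quadForm (V t ω) u = ‖u‖ ^ 2 * quadForm (V t ω) θ := by
    conv_lhs => rw [hθu, quadForm_smul]
  rw [subGammaWeight, e1, e2, psiGamma]
  congr 1
  ring

/-- The set of points at which none of the sets `A s`, `s < t`, has been hit. -/
def notHitBefore {Ω : Type*} (A : ℕ → Set Ω) : ℕ → Set Ω
  | 0 => Set.univ
  | t + 1 => notHitBefore A t \ A t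

theorem iUnion_notHitBefore_inter {Ω : Type*} (A : ℕ → Set Ω) :
    ⋃ t, notHitBefore A t ∩ A t = ⋃ t, A t := by
  refine Set.Subset.antisymm (Set.iUnion_mono fun t => Set.inter_subset_right) ?_
  intro ω hω
  by_contra hcon
  simp only [Set.mem_iUnion, not_exists, Set.mem_inter_iff, not_and] at hcon
  have : ∀ t, ω ∈ notHitBefore A t := by
    intro t
    induction t with
    | zero => exact Set.mem_univ ω
    | succ t ih => exact ⟨ih, hcon t ih⟩
  obtain ⟨t, ht⟩ := Set.mem_iUnion.1 hω
  exact hcon t (this t) ht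

section Ville

variable {Ω : Type*} [m : MeasurableSpace Ω] {μ : Measure Ω} [IsProbabilityMeasure μ]
  {ℱ : Filtration ℕ m} {d : ℕ} {c : ℝ} {S : ℕ → Ω → EuclideanSpace ℝ (Fin d)}
  {V : ℕ → Ω → Matrix (Fin d) (Fin d) ℝ}

theorem measurableSet_notHitBefore {A : ℕ → Set Ω} (hA : ∀ t, MeasurableSet[ℱ t] (A t)) (t : ℕ) :
    MeasurableSet[ℱ t] (notHitBefore A t) := by
  induction t with
  | zero => exact MeasurableSet.univ
  | succ t ih =>
    exact ℱ.mono (Nat.le_succ t) _ (ih.diff (hA t))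

/-- Optional stopping at the first hitting time, by induction: stopped mass is set aside, and the
mass not yet stopped can only decrease in one step. -/
theorem Supermartingale.sum_setIntegral_add_le {L : ℕ → Ω → ℝ} (hL : Supermartingale L ℱ μ)
    {A : ℕ → Set Ω} (hA : ∀ t, MeasurableSet[ℱ t] (A t)) (T : ℕ) :
    ∑ t ∈ Finset.range T, ∫ ω in notHitBefore A t ∩ A t, L t ω ∂μ +
      ∫ ω in notHitBefore A T, L T ω ∂μ ≤ ∫ ω, L 0 ω ∂μ := by
  induction T with
  | zero => simp [notHitBefore]
  | succ T ih =>
    rw [Finset.sum_range_succ]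
    have hC := measurableSet_notHitBefore hA T
    have h1 : ∫ ω in notHitBefore A T ∩ A T, L T ω ∂μ + ∫ ω in notHitBefore A T \ A T, L T ω ∂μ =
        ∫ ω in notHitBefore A T, L T ω ∂μ :=
      integral_inter_add_sdiff (ℱ.le T _ (hA T)) (hL.integrable T).integrableOn
    have h2 : ∫ ω in notHitBefore A (T + 1), L (T + 1) ω ∂μ ≤
        ∫ ω in notHitBefore A T \ A T, L T ω ∂μ :=
      hL.setIntegral_le (Nat.le_succ T) (hC.diff (hA T))
    linarith

theorem Supermartingale.sum_setLIntegral_le {L : ℕ → Ω → ℝ} (hL : Supermartingale L ℱ μ)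
    (h0 : ∀ t, ∀ᵐ ω ∂μ, 0 ≤ L t ω)
    {A : ℕ → Set Ω} (hA : ∀ t, MeasurableSet[ℱ t] (A t)) (T : ℕ) :
    ∑ t ∈ Finset.range T, ∫⁻ ω in notHitBefore A t ∩ A t, ENNReal.ofReal (L t ω) ∂μ ≤
      ENNReal.ofReal (∫ ω, L 0 ω ∂μ) := by
  have h1 : ∀ t, ∫⁻ ω in notHitBefore A t ∩ A t, ENNReal.ofReal (L t ω) ∂μ =
      ENNReal.ofReal (∫ ω in notHitBefore A t ∩ A t, L t ω ∂μ) := fun t =>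
    (ofReal_integral_eq_lintegral_ofReal (hL.integrable t).integrableOn
      (ae_restrict_of_ae (h0 t))).symm
  have h2 : ∀ (t : ℕ) (s : Set Ω), 0 ≤ ∫ ω in s, L t ω ∂μ := fun t s =>
    integral_nonneg_of_ae (ae_restrict_of_ae (h0 t))
  rw [Finset.sum_congr rfl fun t _ => h1 t, ← ENNReal.ofReal_sum_of_nonneg fun t _ => h2 t _]
  refine ENNReal.ofReal_le_ofReal ?_
  have := Supermartingale.sum_setIntegral_add_le hL hA T
  linarith [h2 T (notHitBefore A T)]

/-- Ville's inequality for mixtures of the exponential weights over a measure of mass at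
most one. -/
theorem IsSubGamma.measure_exists_le_lintegral_le (hSV : IsSubGamma μ ℱ c S V)
    (hd : 0 < d) (ν : Measure (EuclideanSpace ℝ (Fin d))) [SFinite ν] (hν1 : ν Set.univ ≤ 1)
    (hν : ∀ᵐ u ∂ν, ‖u‖ < 1 / c) {δ : ℝ} (hδ : 0 < δ) :
    μ {ω | ∃ t, ENNReal.ofReal (1 / δ) ≤
      ∫⁻ u, ENNReal.ofReal (subGammaWeight c (S t ω) (V t ω) u) ∂ν} ≤ ENNReal.ofReal δ := by
  set A : ℕ → Set Ω := fun t => {ω | ENNReal.ofReal (1 / δ) ≤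
    ∫⁻ u, ENNReal.ofReal (subGammaWeight c (S t ω) (V t ω) u) ∂ν} with hAdef
  have hA : ∀ t, MeasurableSet[ℱ t] (A t) := fun t =>
    @measurableSet_le_lintegral_subGammaWeight Ω (ℱ t) d c (S t) (V t) (hSV.adapted_S t)
      (hSV.adapted_V t) ν _ _
  have hm : ∀ t, Measurable fun p : Ω × EuclideanSpace ℝ (Fin d) =>
      ENNReal.ofReal (subGammaWeight c (S t p.1) (V t p.1) p.2) := fun t =>
    measurable_subGammaWeight c ((hSV.adapted_S t).mono (ℱ.le t)) ((hSV.adapted_V t).mono (ℱ.le t))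
  set B : ℕ → Set Ω := fun t => notHitBefore A t ∩ A t with hB
  have hBm : ∀ t, MeasurableSet (B t) := fun t =>
    ℱ.le t _ ((measurableSet_notHitBefore hA t).inter (hA t))
  have hset : {ω | ∃ t, ENNReal.ofReal (1 / δ) ≤
      ∫⁻ u, ENNReal.ofReal (subGammaWeight c (S t ω) (V t ω) u) ∂ν} = ⋃ t, B t := by
    rw [hB, iUnion_notHitBefore_inter]
    ext ω
    simp [hAdef]
  -- The dominating supermartingale depends on `u` with no measurability in `u`, so it cannot itself
  -- be mixed. It is used for each `u` separately to bound the stopped weights; Tonelli is then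
  -- applied to the weights, which are jointly measurable.
  have hpt : ∀ T, ∀ᵐ u ∂ν, ∑ t ∈ Finset.range T,
      ∫⁻ ω in B t, ENNReal.ofReal (subGammaWeight c (S t ω) (V t ω) u) ∂μ ≤ 1 := by
    intro T
    filter_upwards [hν] with u hu
    obtain ⟨L, h1, h2, h3, h4⟩ := hSV.exists_supermartingale hd hu
    refine le_trans ?_ ((Supermartingale.sum_setLIntegral_le h1 h2 hA T).trans ?_)
    · refine Finset.sum_le_sum fun t _ => lintegral_mono_ae (ae_restrict_of_ae ?_)
      filter_upwards [h4 t] with ω hω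
      exact ENNReal.ofReal_le_ofReal hω
    · rw [← ENNReal.ofReal_one]
      exact ENNReal.ofReal_le_ofReal h3
  have hsum : ∀ T, ∑ t ∈ Finset.range T, μ (B t) ≤ ENNReal.ofReal δ := by
    intro T
    have h1 : ∑ t ∈ Finset.range T, ENNReal.ofReal (1 / δ) * μ (B t) ≤ 1 := by
      calc ∑ t ∈ Finset.range T, ENNReal.ofReal (1 / δ) * μ (B t)
          ≤ ∑ t ∈ Finset.range T, ∫⁻ ω in B t,
              ∫⁻ u, ENNReal.ofReal (subGammaWeight c (S t ω) (V t ω) u) ∂ν ∂μ := by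
            refine Finset.sum_le_sum fun t _ => ?_
            rw [← setLIntegral_const]
            exact setLIntegral_mono' (hBm t) fun ω hω => hω.2
        _ = ∑ t ∈ Finset.range T, ∫⁻ u, ∫⁻ ω in B t,
              ENNReal.ofReal (subGammaWeight c (S t ω) (V t ω) u) ∂μ ∂ν :=
            Finset.sum_congr rfl fun t _ => lintegral_lintegral_swap (hm t).aemeasurable
        _ = ∫⁻ u, ∑ t ∈ Finset.range T, ∫⁻ ω in B t,
              ENNReal.ofReal (subGammaWeight c (S t ω) (V t ω) u) ∂μ ∂ν :=
            (lintegral_finsetSum _ fun t _ => (hm t).lintegral_prod_left').symm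
        _ ≤ ∫⁻ _, 1 ∂ν := lintegral_mono_ae (hpt T)
        _ ≤ 1 := by simpa using hν1
    rw [← Finset.mul_sum, one_div, ENNReal.ofReal_inv_of_pos hδ] at h1
    have h0 : ENNReal.ofReal δ ≠ 0 := by simpa using hδ
    calc ∑ t ∈ Finset.range T, μ (B t)
        = ENNReal.ofReal δ * ((ENNReal.ofReal δ)⁻¹ * ∑ t ∈ Finset.range T, μ (B t)) := by
          rw [← mul_assoc, ENNReal.mul_inv_cancel h0 ENNReal.ofReal_ne_top, one_mul]
      _ ≤ ENNReal.ofReal δ * 1 := by gcongr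
      _ = ENNReal.ofReal δ := mul_one _
  rw [hset]
  exact (measure_iUnion_le _).trans (ENNReal.tsum_le_of_sum_range_le hsum)

end Ville

/-! ### Scalar inequalities balancing the radius of the ellipsoid -/

section RealInequalities

theorem exp_two_mul_bound {X : ℝ} (hX : 0 ≤ X) :
    1 + 2 * X + 2 * X ^ 2 + 4 / 3 * X ^ 3 ≤ Real.exp (2 * X) := by
  have h := Real.sum_le_exp_of_nonneg (x := 2 * X) (by linarith) 4
  norm_num [Finset.sum_range_succ, Nat.factorial] at h
  nlinarith [h]

/-- Used with `E = exp(2X)`, of which the cubic is a Taylor polynomial. The constant `0.2928` lies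
just below `1 - 1/√2`, the bound on the slack in `radius_slack_bounds`. -/
theorem sub_mul_sub_ge_of_cubic_le {X E : ℝ} (hX : 0 ≤ X)
    (hE : 1 + 2 * X + 2 * X ^ 2 + 4 / 3 * X ^ 3 ≤ E) :
    X ≤ (0.2928 * E - X) * (E - 1 / 2) := by
  set P := 1 + 2 * X + 2 * X ^ 2 + 4 / 3 * X ^ 3 with hP
  have h1 : X ≤ (0.2928 * P - X) * (P - 1 / 2) := by
    have t0 := sq_nonneg (X - 0.326)
    rw [hP]
    nlinarith [t0, mul_nonneg hX t0, mul_nonneg (pow_nonneg hX 2) t0, mul_nonneg (pow_nonneg hX 3) t0,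
      mul_nonneg (pow_nonneg hX 4) t0]
  have h2 : 0 ≤ 0.2928 * P - X := by
    rw [hP]; nlinarith [sq_nonneg (X - 0.3), pow_nonneg hX 3]
  have h3 : 1 ≤ P := by rw [hP]; nlinarith [pow_nonneg hX 3, pow_nonneg hX 2]
  nlinarith [mul_nonneg h2 (sub_nonneg.2 hE), mul_nonneg (sub_nonneg.2 hE) (show 0 ≤ E - 1 / 2 by linarith)]

/-- Balancing inequality for a radius multiplier `w ∈ [1, 2]`, when the correction is nonpositive. -/
theorem radius_balance_of_le {a D w : ℝ} (ha : 0 < a) (h1 : a ^ 2 ≤ D) (h2 : D ≤ 2 * a ^ 2)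
    (hw1 : 1 ≤ w) (hw2 : w ≤ 2) :
    a * w / 2 + D / (a * w) ≤ D / a + √(D / 2) := by
  have hD : 0 < D := lt_of_lt_of_le (by positivity) h1
  set β := √(D / 2) with hβ
  have hb2 : β ^ 2 = D / 2 := Real.sq_sqrt (by positivity)
  have hb0 : 0 < β := Real.sqrt_pos.2 (by positivity)
  have hDβ : D = 2 * β ^ 2 := by linarith
  have ha1 : a ≤ 1.42 * β := by
    by_contra h; push Not at h; nlinarith
  have ha2 : β ≤ a := by
    by_contra h; push Not at h; nlinarith
  have hw : 0 < w := by linarith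
  -- The difference of the two sides is convex in `w`, so the endpoints `w = 1` (`e1`) and `w = 2`
  -- (`e2`) suffice.
  have key : a ^ 2 * w ^ 2 / 2 + D ≤ D * w + β * a * w := by
    have e1 : a ^ 2 / 2 ≤ β * a := by nlinarith
    have e2 : 2 * a ^ 2 ≤ D + 2 * (β * a) := by nlinarith
    have e3 : a ^ 2 * ((w - 1) * (2 - w)) ≥ 0 := by
      have := mul_nonneg (sub_nonneg.2 hw1) (sub_nonneg.2 hw2); positivity
    nlinarith [mul_nonneg (sub_nonneg.2 hw1) (sub_nonneg.2 e2), mul_nonneg (sub_nonneg.2 hw2) (sub_nonneg.2 e1)]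
  have e : D / a + β - (a * w / 2 + D / (a * w)) =
      (D * w + β * a * w - (a ^ 2 * w ^ 2 / 2 + D)) / (a * w) := by
    field_simp
  have : 0 ≤ (D * w + β * a * w - (a ^ 2 * w ^ 2 / 2 + D)) / (a * w) :=
    div_nonneg (by linarith) (by positivity)
  linarith

/-- The relative slack `1 + (w - 1) / z - z` of the radius balance is bounded below. -/
theorem radius_slack_bounds {w z : ℝ} (hw1 : 1 ≤ w) (hw2 : w ≤ 2) (hz1 : w ≤ 2 * z)
    (hz2 : 2 * z ^ 2 ≤ w ^ 2) :
    0.2928 ≤ 1 + (w - 1) / z - z ∧ 1 + (w - 1) / z - z ≤ 1 ∧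
      0.2928 / √2 * (1 / z) ≤ 1 + (w - 1) / z - z := by
  have hz : 0 < z := by linarith
  set q := √2 with hq
  have hq2 : q ^ 2 = 2 := Real.sq_sqrt (by norm_num)
  have hq0 : 0 < q := by positivity
  have hq3 : q ≤ 1.41422 := by
    by_contra h; push Not at h; nlinarith
  have hq4 : 1.41421 ≤ q := by
    by_contra h; push Not at h; nlinarith
  have hz3 : q * z ≤ w := by
    refine le_of_sq_le_sq ?_ (by linarith)
    nlinarith
  have hz4 : z ≤ q / 2 * w := by nlinarith
  have hz5 : z ≤ 0.70711 * w := by nlinarith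
  have e : 1 + (w - 1) / z - z = (z + w - 1 - z ^ 2) / z := by field_simp; ring
  have e2 : 0.2928 / q * (1 / z) = (0.2928 / q) / z := by ring
  have hi : 0.2928 / q ≤ 0.20705 := by
    rw [div_le_iff₀ hq0]; nlinarith
  have conc := mul_nonneg (sub_nonneg.2 hz1) (sub_nonneg.2 hz5)
  have concw := mul_nonneg (sub_nonneg.2 hw1) (sub_nonneg.2 hw2)
  rw [e2, e]
  refine ⟨?_, ?_, ?_⟩
  · rw [le_div_iff₀ hz]
    nlinarith
  · rw [div_le_iff₀ hz]
    nlinarith [sq_nonneg (w - 2)]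
  · refine (div_le_div_iff_of_pos_right hz).2 (hi.trans ?_)
    nlinarith

/-- Balancing inequality for a radius multiplier `w ∈ [1, 2]`, when the correction `X` is
positive and hence the scale `c` is bounded below. -/
theorem radius_balance_of_pos {a D w c E X A t : ℝ} (ha : 0 < a) (h1 : a ^ 2 ≤ D)
    (h2 : D ≤ 2 * a ^ 2) (hw1 : 1 ≤ w) (hw2 : w ≤ 2) (hX : 0 ≤ X)
    (hE : 1 + 2 * X + 2 * X ^ 2 + 4 / 3 * X ^ 3 ≤ E) (hD : 1 + X ≤ D) (hc : E - 1 / 2 ≤ c)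
    (hA : c * E * t ^ 2 ≤ A) (ht1 : t ≤ 1) :
    a * w / 2 + (D + X) / (a * w) + (D + X) * c * t ≤ c * D + D / a + max A √(D / 2) := by
  have hX2 : 0 ≤ X ^ 2 := by positivity
  have hX3 : 0 ≤ X ^ 3 := by positivity
  have hE1 : 1 ≤ E := by linarith
  have hc0 : 0 < c := by linarith
  set β := √(D / 2) with hβ
  have hb2 : β ^ 2 = D / 2 := Real.sq_sqrt (by linarith)
  have hb0 : 0 < β := Real.sqrt_pos.2 (by linarith)
  have hDβ : D = 2 * β ^ 2 := by linarith
  -- In this variable `D/a + β` exceeds `a w/2 + D/(a w)` by exactly `Z β` (`e4` below). That slack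
  -- must pay for the terms in `X`.
  set z := a * w / (2 * β) with hz
  have haz : a = 2 * β * z / w := by rw [hz]; field_simp
  have hw0 : 0 < w := by linarith
  have hz0 : 0 < z := by positivity
  have hz1 : w ≤ 2 * z := by
    have : β ≤ a := by by_contra h; push Not at h; nlinarith only [h, ha, h2, hDβ, hb0]
    rw [hz, mul_div_assoc', le_div_iff₀ (by positivity)]
    nlinarith only [this, hw0]
  have hz2 : 2 * z ^ 2 ≤ w ^ 2 := by
    rw [hz, div_pow, mul_div_assoc', div_le_iff₀ (by positivity)]
    nlinarith only [mul_le_mul_of_nonneg_left h1 (sq_nonneg w), hDβ]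
  obtain ⟨s1, s2, s3⟩ := radius_slack_bounds hw1 hw2 hz1 hz2
  set Z := 1 + (w - 1) / z - z with hZ
  set ρ := X / (E - 1 / 2) with hρ
  have hρ0 : 0 ≤ ρ := div_nonneg hX (by linarith)
  have hρX : ρ * (E - 1 / 2) = X := div_mul_cancel₀ X (by linarith)
  have hρ1 : ρ ≤ 0.2928 * E - X := by
    rw [hρ, div_le_iff₀ (by linarith)]
    exact sub_mul_sub_ge_of_cubic_le hX hE
  have hρ2 : ρ ≤ 0.3535 := by
    rw [hρ, div_le_iff₀ (by linarith)]
    nlinarith only [sq_nonneg (X - 0.2), hE, hX3, hX]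
  have hq2 : √2 ^ 2 = (2 : ℝ) := Real.sq_sqrt (by norm_num)
  have hq0 : 0 < √(2 : ℝ) := by positivity
  have hq4 : 1.41421 ≤ √(2 : ℝ) := by
    by_contra h; push Not at h; nlinarith only [h, hq2, hq0]
  have hq5 : √(2 : ℝ) ≤ 1.41422 := by
    by_contra h; push Not at h; nlinarith only [h, hq2, hq0]
  have hβ1 : √2 ≤ 2 * β := by
    refine le_of_sq_le_sq ?_ (by positivity)
    nlinarith only [hq2, hDβ, hD, hX]
  have c1 : X / (2 * β * z) ≤ c * (ρ / √2 * (1 / z)) := by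
    have : X / (2 * β * z) = (X / (2 * β)) * (1 / z) := by field_simp
    rw [this, ← mul_assoc]
    refine mul_le_mul_of_nonneg_right ?_ (by positivity)
    rw [mul_div_assoc', div_le_div_iff₀ (by positivity) hq0]
    have : X ≤ c * ρ := by rw [← hρX, mul_comm]; exact mul_le_mul_of_nonneg_right hc hρ0
    exact mul_le_mul this hβ1 hq0.le (by positivity)
  have c2 : ρ / √2 * (1 / z) ≤ 1 / 2 := by
    rw [div_mul_div_comm, mul_one, div_le_iff₀ (by positivity)]
    nlinarith only [hρ2, hq4, hz1, hw1]
  have c3 : ρ / √2 * (1 / z) ≤ Z * E - X := by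
    have e1 : ρ / √2 * (1 / z) ≤ ρ / 0.2928 * Z := by
      have : ρ / √2 * (1 / z) = ρ / 0.2928 * (0.2928 / √2 * (1 / z)) := by ring
      rw [this]
      exact mul_le_mul_of_nonneg_left s3 (by positivity)
    have e2 : 0.2928 * (E - ρ / 0.2928) ≤ Z * (E - ρ / 0.2928) := by
      refine mul_le_mul_of_nonneg_right s1 ?_
      rw [sub_nonneg, div_le_iff₀ (by norm_num)]
      nlinarith only [hρ1, hX]
    have e3 : 0.2928 * (E - ρ / 0.2928) = 0.2928 * E - ρ := by ring
    nlinarith only [e1, e2, e3, hρ1]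
  -- The right side is quadratic in `t ≤ 1`. Either its leading coefficient is large and it stays
  -- above `1/2`, or it decreases up to `t = 1`, where its value is `Z E - X`.
  have c4 : ρ / √2 * (1 / z) ≤ Z * E * t ^ 2 - (1 + 2 * X) * t + 1 + X := by
    rcases le_total ((1 + 2 * X) / 2) (Z * E) with h | h
    · refine c2.trans ?_
      nlinarith only [mul_nonneg (show 0 ≤ 1 + 2 * X by linarith) (sq_nonneg (t - 1)), mul_le_mul_of_nonneg_right h (sq_nonneg t)]
    · refine c3.trans ?_
      have : 0 ≤ (1 - t) * ((1 + 2 * X) - Z * E * (1 + t)) := by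
        refine mul_nonneg (by linarith) ?_
        have : 0 ≤ Z * E := mul_nonneg (by linarith) (by linarith)
        nlinarith only [this, h, ht1]
      nlinarith only [this]
  -- Since `Z ≤ 1`, the maximum lets the slack `Zβ` be traded for `Z A`, and `A` controls `c E t²`.
  have c5 : β + Z * A ≤ Z * β + max A β := by
    rcases le_total A β with h | h
    · rw [max_eq_right h]; nlinarith only [mul_le_mul_of_nonneg_left h (show 0 ≤ Z by linarith)]
    · rw [max_eq_left h]; nlinarith only [mul_nonneg (sub_nonneg.2 h) (sub_nonneg.2 s2)]
  have c6 : Z * (c * E * t ^ 2) ≤ Z * A := mul_le_mul_of_nonneg_left hA (by linarith)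
  have e1 : a * w / 2 = β * z := by rw [hz]; field_simp
  have e2 : (D + X) / (a * w) = β / z + X / (2 * β * z) := by
    have : a * w = 2 * β * z := by rw [hz]; field_simp
    rw [this, hDβ]; field_simp
  have e3 : D / a = β * w / z := by rw [hDβ, haz]; field_simp
  have e4 : Z * β = β + β * w / z - β / z - β * z := by rw [hZ]; field_simp; ring
  rw [e1, e2, e3]
  have c7 : (1 + X) * (1 - t) ≤ D * (1 - t) := mul_le_mul_of_nonneg_right hD (by linarith)
  have c8 := mul_le_mul_of_nonneg_left c4 hc0.le
  have c9 := mul_le_mul_of_nonneg_left c7 hc0.le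
  linarith only [c1, c8, c9, c6, c5, e4]

/-- Balancing inequality for the radius multiplier `2`. -/
theorem radius_balance_two {a D c lam R : ℝ} (ha : 0 < a) (h1 : a ^ 2 ≤ D) (h2 : D ≤ 2 * a ^ 2)
    (hlam : 0 ≤ lam) (hR1 : lam * (1 + R) ≤ 3 + √2 * (c * √D * (1 - lam * R / 2)))
    (hR2 : lam * (2 + R) ≤ 2 + √2 + 2 * (c * √D * (1 - lam * R / 2))) :
    lam * (a + D * R / (2 * a) + D * R * c / 2) ≤ c * D + D / a + √(D / 2) := by
  have hD : 0 < D := lt_of_lt_of_le (by positivity) h1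
  set b := √D with hb
  have hb0 : 0 < b := Real.sqrt_pos.2 hD
  have hb2 : b ^ 2 = D := Real.sq_sqrt hD.le
  set q := √2 with hq
  have hq2 : q ^ 2 = (2 : ℝ) := Real.sq_sqrt (by norm_num)
  have hq0 : 0 < q := by positivity
  have hβ : √(D / 2) = b * q / 2 := by
    rw [Real.sqrt_div' _ (by norm_num), ← hb, ← hq]
    field_simp; nlinarith
  set u := a / b with hu
  have hab : a = u * b := by rw [hu]; field_simp
  have hu0 : 0 < u := by positivity
  have hu1 : u ≤ 1 := by
    rw [hu, div_le_one hb0]; exact le_of_sq_le_sq (by linarith) hb0.le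
  have hu2 : q / 2 ≤ u := by
    rw [hu, le_div_iff₀ hb0]
    refine le_of_sq_le_sq ?_ ha.le
    nlinarith
  set G := c * b * (1 - lam * R / 2) with hG
  have hq3 : q < 1.5 := by by_contra h; push Not at h; nlinarith
  -- Bounding `u²` by its chord on `[√2/2, 1]` makes the claim linear in `u`; the hypotheses `hR1`
  -- and `hR2` are its two endpoints.
  have key : lam * (2 * u ^ 2 + R) ≤ 2 + q * u + 2 * G * u := by
    have hch : 2 * u ^ 2 ≤ (2 + q) * u - q := by nlinarith [mul_nonneg (sub_nonneg.2 hu1) (sub_nonneg.2 hu2)]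
    have e1 : lam * (2 * u ^ 2 + R) ≤ lam * ((2 + q) * u - q + R) :=
      mul_le_mul_of_nonneg_left (by linarith) hlam
    have e2 : 0 ≤ (u - q / 2) * (2 + q + 2 * G - lam * (2 + R)) :=
      mul_nonneg (by linarith) (by linarith)
    have e3 : 0 ≤ (1 - u) * (3 + q * G - lam * (1 + R)) :=
      mul_nonneg (by linarith) (by linarith)
    have e4 : (1 - q / 2) * (lam * ((2 + q) * u - q + R)) ≤ (1 - q / 2) * (2 + q * u + 2 * G * u) := by
      have : (1 - u) * (q ^ 2 - 2) / 2 * (1 - lam) = 0 := by rw [hq2]; ring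
      nlinarith only [e2, e3, this]
    exact e1.trans (le_of_mul_le_mul_left e4 (by linarith))
  have e : c * D + D / a + √(D / 2) - lam * (a + D * R / (2 * a) + D * R * c / 2) =
      b / (2 * u) * (2 + q * u + 2 * G * u - lam * (2 * u ^ 2 + R)) := by
    rw [hβ, hG, hab, ← hb2]; field_simp; ring
  have : 0 ≤ b / (2 * u) * (2 + q * u + 2 * G * u - lam * (2 * u ^ 2 + R)) :=
    mul_nonneg (by positivity) (by linarith)
  linarith

end RealInequalities

/-! ### Choice of the ellipsoid size `K` and of `y` -/

section RadiusMultiplier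

/-- Here the largest admissible `K = √(v/s)` lies in `[1, 2]`, and `y = 1 - H²` makes `√(1-y)` equal
to `H`, which cancels. What remains is a radius balance with the correction `X = log(x/y²)/2`,
harmless if nonpositive. -/
theorem exists_radius_multiplier_of_le_four {d c γ v D a A s h H : ℝ} (hd : 1 ≤ d) (hc : 0 < c)
    (hγ : 0 < γ) (hv : 1 ≤ v) (h0 : 0 < h) (hh : 1 / h ≤ c + 1 / 2)
    (hH : H = √(1 - γ / v) - √(γ / v * h)) (hH0 : 0 < H)
    (hD : 1 + d / 2 * Real.log (v / γ) ≤ D) (ha : 0 < a) (h1 : a ^ 2 ≤ D) (h2 : D ≤ 2 * a ^ 2)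
    (hA : c / γ ≤ A) (hs : 1 ≤ s) (hsv : s ≤ v) (hvs : v ≤ 4 * s) :
    ∃ K y, 0 < K ∧ K ^ 2 * s ≤ v ∧ 0 < y ∧ y < 1 ∧
      H * (a * K ^ 2 / 2 + (D + (d / 2 * Real.log (γ / (s * K ^ 2 * y)) + Real.log (1 / y) / 2)) *
        (1 / a + c / √s)) ≤ K * √(1 - y) * (c * D + D / a + max A √(D / 2)) := by
  have hv0 : 0 < v := by linarith
  have hs0 : 0 < s := by linarith
  set x := γ / v with hx
  have hx0 : 0 < x := div_pos hγ hv0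
  set p := √(1 - x) with hp
  set r := √(x * h) with hr
  have hr0 : 0 < r := Real.sqrt_pos.2 (by positivity)
  have hp0 : 0 < p := by linarith
  have hx1 : 0 < 1 - x := Real.sqrt_pos.1 hp0
  have hp2 : p ^ 2 = 1 - x := Real.sq_sqrt hx1.le
  have hr2 : r ^ 2 = x * h := Real.sq_sqrt (by positivity)
  set y := 1 - H ^ 2 with hy
  have hyx : x + r * p ≤ y := by
    rw [hy, hH]; nlinarith only [hp2, hr0, hH0, hH]
  have hrp : 0 < r * p := mul_pos hr0 hp0
  have hy0 : 0 < y := by linarith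
  have hy1 : y < 1 := by rw [hy]; nlinarith only [hH0]
  have hyx2 : x ^ 2 + x * h * (1 - x) ≤ y ^ 2 := by
    rw [← hr2, ← hp2]
    have : (x + r * p) ^ 2 ≤ y ^ 2 := pow_le_pow_left₀ (by positivity) hyx 2
    nlinarith only [this, mul_pos hx0 hrp]
  set K := √(v / s) with hK
  have hK2 : K ^ 2 = v / s := Real.sq_sqrt (by positivity)
  have hK0 : 0 < K := Real.sqrt_pos.2 (by positivity)
  have hK1 : 1 ≤ K := by
    rw [hK, Real.one_le_sqrt, le_div_iff₀ hs0]; linarith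
  have hK3 : K ≤ 2 := by
    rw [hK, Real.sqrt_le_left (by norm_num), div_le_iff₀ hs0]; linarith
  have hKs : K ^ 2 * s = v := by rw [hK2]; field_simp
  refine ⟨K, y, hK0, hKs.le, hy0, hy1, ?_⟩
  have e1 : √(1 - y) = H := by
    rw [hy, sub_sub_cancel, Real.sqrt_sq hH0.le]
  have e2 : γ / (s * K ^ 2 * y) = x / y := by
    rw [mul_comm s, hKs, hx]; field_simp
  set X := Real.log (x / y ^ 2) / 2 with hX
  have hlog : Real.log (1 / y) = - Real.log y := by rw [one_div, Real.log_inv]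
  have hXle : d / 2 * Real.log (x / y) + Real.log (1 / y) / 2 ≤ X := by
    have hneg : Real.log (x / y) ≤ 0 :=
      Real.log_nonpos (by positivity) ((div_le_one hy0).2 (by linarith))
    have : Real.log (x / y ^ 2) = Real.log (x / y) + Real.log (1 / y) := by
      rw [← Real.log_mul (by positivity) (by positivity)]; congr 1; field_simp
    rw [hX, this]
    nlinarith only [hneg, hd]
  have hss : √s ^ 2 = s := Real.sq_sqrt hs0.le
  have hss0 : 0 < √s := Real.sqrt_pos.2 hs0
  set t := 1 / (K * √s) with ht
  have ht0 : 0 < t := by positivity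
  have ht2 : t ^ 2 = 1 / v := by rw [ht, div_pow, mul_pow, hss, hKs, one_pow]
  have ht1 : t ≤ 1 := by
    rw [← abs_of_pos ht0, ← sq_le_one_iff_abs_le_one, ht2, div_le_one hv0]; exact hv
  have suff : ∀ Z, d / 2 * Real.log (x / y) + Real.log (1 / y) / 2 ≤ Z →
      a * K / 2 + (D + Z) / (a * K) + (D + Z) * c * t ≤ c * D + D / a + max A √(D / 2) →
      H * (a * K ^ 2 / 2 + (D + (d / 2 * Real.log (x / y) + Real.log (1 / y) / 2)) *
        (1 / a + c / √s)) ≤ K * H * (c * D + D / a + max A √(D / 2)) := by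
    intro Z hZ hle
    have e : K * H * (a * K / 2 + (D + Z) / (a * K) + (D + Z) * c * t) =
        H * (a * K ^ 2 / 2 + (D + Z) * (1 / a + c / √s)) := by
      rw [ht]; field_simp; ring
    calc _ ≤ H * (a * K ^ 2 / 2 + (D + Z) * (1 / a + c / √s)) := by gcongr
      _ = _ := e.symm
      _ ≤ _ := by gcongr
  rw [e1, e2]
  rcases le_or_gt x (y ^ 2) with hxy | hxy
  · refine suff 0 (hXle.trans ?_) ?_
    · rw [hX]
      have := Real.log_nonpos (by positivity) ((div_le_one (by positivity)).2 hxy)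
      linarith
    · have hb := radius_balance_of_le ha h1 h2 hK1 hK3
      have hD0 : 0 < D := lt_of_lt_of_le (by positivity) h1
      have : D * c * t ≤ c * D := by nlinarith only [mul_pos hD0 hc, ht1]
      have := le_max_right A √(D / 2)
      rw [add_zero]; linarith
  · refine suff X hXle ?_
    set E := x / y ^ 2 with hE
    have hE1 : 1 < E := (one_lt_div (by positivity)).2 hxy
    have hX0 : 0 ≤ X := by
      have := Real.log_nonneg hE1.le
      rw [hX]; linarith
    have hEexp : Real.exp (2 * X) = E := by
      rw [hX, mul_div_cancel₀ _ (two_ne_zero), Real.exp_log (by linarith)]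
    have hEv : E ≤ v / γ := by
      rw [hE, div_le_div_iff₀ (by positivity) hγ]
      have : x ^ 2 ≤ y ^ 2 := pow_le_pow_left₀ hx0.le (by linarith) 2
      have hxv : x * v = γ := by rw [hx]; field_simp
      rw [← hxv]; nlinarith only [this, hv0]
    -- A positive correction forces `h < 1`, as `h ≥ 1` would give `y² ≥ x`. Then `E ≤ 1/h ≤ c +
    -- 1/2`, so the scale `c` is large enough to absorb it.
    have hEh : E ≤ 1 / h := by
      have hh1 : h < 1 := by
        by_contra hcon
        push Not at hcon
        nlinarith only [hcon, hxy, hyx2, mul_pos hx0 hx1, mul_nonneg (mul_pos hx0 hx1).le (sub_nonneg.2 hcon)]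
      rw [hE, div_le_div_iff₀ (by positivity) h0, one_mul]
      nlinarith only [hyx2, mul_pos (pow_pos hx0 2) (sub_pos.2 hh1)]
    refine radius_balance_of_pos ha h1 h2 hK1 hK3 hX0 (hEexp ▸ exp_two_mul_bound hX0) ?_
      (by linarith) ?_ ht1
    · have : Real.log E ≤ Real.log (v / γ) := Real.log_le_log (by linarith) hEv
      have h3 : 0 ≤ Real.log E := Real.log_nonneg hE1.le
      have hXE : X = Real.log E / 2 := hX
      nlinarith only [hD, this, h3, hd, hXE]
    · rw [ht2]
      refine le_trans ?_ hA
      rw [mul_one_div, div_le_div_iff₀ hv0 hγ]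
      have := (le_div_iff₀ hγ).1 hEv
      nlinarith only [this, hc]

/-- For `K = 2`, the logarithmic correction enters only through the ratio `R` and the factor `H`
only through `lam`; this reduces the claim to the two endpoint inequalities of `radius_balance_two`.
-/
theorem radius_two_of_balance {c D a A s lam R H y X : ℝ} (hc : 0 < c) (ha : 0 < a)
    (h1 : a ^ 2 ≤ D) (h2 : D ≤ 2 * a ^ 2) (hs : 1 ≤ s) (hH0 : 0 < H)
    (hH : H ≤ lam * √(1 - y)) (hy : y < 1) (hX : D + X ≤ D * R)
    (hR0 : 0 ≤ R)
    (hR1 : lam * (1 + R) ≤ 3 + √2 * (c * √D * (1 - lam * R / 2)))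
    (hR2 : lam * (2 + R) ≤ 2 + √2 + 2 * (c * √D * (1 - lam * R / 2))) :
    H * (a * 2 ^ 2 / 2 + (D + X) * (1 / a + c / √s)) ≤
      2 * √(1 - y) * (c * D + D / a + max A √(D / 2)) := by
  have hq : 0 < √(1 - y) := Real.sqrt_pos.2 (by linarith)
  have hlam : 0 ≤ lam := by
    by_contra h; push Not at h; nlinarith
  have hD : 0 < D := lt_of_lt_of_le (by positivity) h1
  have hb := radius_balance_two ha h1 h2 hlam hR1 hR2
  have hs1 : c / √s ≤ c := div_le_self hc.le (Real.one_le_sqrt.2 hs)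
  have hm := le_max_right A √(D / 2)
  calc H * (a * 2 ^ 2 / 2 + (D + X) * (1 / a + c / √s))
      ≤ H * (a * 2 ^ 2 / 2 + (D * R) * (1 / a + c)) := by gcongr
    _ ≤ lam * √(1 - y) * (a * 2 ^ 2 / 2 + (D * R) * (1 / a + c)) := by gcongr
    _ = 2 * √(1 - y) * (lam * (a + D * R / (2 * a) + D * R * c / 2)) := by field_simp; ring
    _ ≤ 2 * √(1 - y) * (c * D + D / a + max A √(D / 2)) := by gcongr; linarith

theorem one_sub_mul_le_of_log {z : ℝ} (hz0 : 0 < z) (hz1 : z ≤ 0.3536) :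
    1.06905 * (1 - z) * (3 + 1.03973 / (1 - Real.log z)) ≤ 3.4142 := by
  have hl2 := Real.log_two_lt_d9
  have hl3 := Real.log_two_gt_d9
  have hlog : ∀ m : ℕ, Real.log z ≤ 2 ^ m * z - 1 - m * Real.log 2 := by
    intro m
    have := Real.log_le_sub_one_of_pos (x := 2 ^ m * z) (by positivity)
    rw [Real.log_mul (by positivity) hz0.ne', Real.log_pow] at this
    linarith
  -- The tangent of `log` at `2^(-m)` gives `1 - log z ≥ 2 + m log 2 - 2^m z`; `m = 5` and `m = 3`
  -- cover the range, leaving polynomial inequalities.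
  have main : ∀ P : ℝ, 0 < P → P ≤ 1 - Real.log z →
      1.06905 * (1 - z) * (3 * P + 1.03973) ≤ 3.4142 * P →
      1.06905 * (1 - z) * (3 + 1.03973 / (1 - Real.log z)) ≤ 3.4142 := by
    intro P hP hPl hle
    have e1 : 1.03973 / (1 - Real.log z) ≤ 1.03973 / P := by gcongr
    calc 1.06905 * (1 - z) * (3 + 1.03973 / (1 - Real.log z))
        ≤ 1.06905 * (1 - z) * (3 + 1.03973 / P) := by
          refine mul_le_mul_of_nonneg_left (by linarith) ?_
          nlinarith
      _ = 1.06905 * (1 - z) * (3 * P + 1.03973) / P := by field_simp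
      _ ≤ 3.4142 := by rw [div_le_iff₀ hP]; exact hle
  rcases le_total z 0.09 with h | h
  · have := hlog 5
    norm_num at this
    refine main (5.4657 - 32 * z) (by linarith) (by linarith) ?_
    nlinarith
  · have := hlog 3
    norm_num at this
    refine main (4.0794 - 8 * z) (by linarith) (by linarith) ?_
    nlinarith

theorem exists_radius_multiplier_two_of_one_le {d c γ v D a A s h H : ℝ} (hd : 1 ≤ d) (hc : 0 < c)
    (hγ : 0 < γ) (h0 : 1 ≤ h)
    (hH : H = √(1 - γ / v) - √(γ / v * h)) (hH0 : 0 < H)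
    (hD : 1 + d / 2 * Real.log (v / γ) ≤ D) (ha : 0 < a) (h1 : a ^ 2 ≤ D) (h2 : D ≤ 2 * a ^ 2)
    (hs : 1 ≤ s) (hsγ : γ * (1 + h) ≤ s) (hvs : 4 * s < v) :
    ∃ y, 0 < y ∧ y < 1 ∧
      H * (a * 2 ^ 2 / 2 + (D + (d / 2 * Real.log (γ / (s * 2 ^ 2 * y)) + Real.log (1 / y) / 2)) *
        (1 / a + c / √s)) ≤ 2 * √(1 - y) * (c * D + D / a + max A √(D / 2)) := by
  have hl2 := Real.log_two_lt_d9
  have hl3 := Real.log_two_gt_d9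
  -- With `y = 1/8`, the first logarithm is that of `2γ/s ≤ 1`, so the correction is at most `(3/2)
  -- log 2 < 1.03973`; and `1.06905` is just above `1/√(7/8)`.
  refine ⟨1 / 8, by norm_num, by norm_num, ?_⟩
  have hv0 : 0 < v := by linarith
  set x := γ / v with hx
  have hx0 : 0 < x := div_pos hγ hv0
  have hx1 : x ≤ 1 / 8 := by
    rw [hx, div_le_iff₀ hv0]; nlinarith
  set z := √x with hz
  have hz0 : 0 < z := Real.sqrt_pos.2 hx0
  have hz2 : z ^ 2 = x := Real.sq_sqrt hx0.le
  have hz1 : z ≤ 0.3536 := by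
    by_contra hcon; push Not at hcon; nlinarith only [hcon, hz2, hx1]
  have hHz : H ≤ 1 - z := by
    have e1 : √(1 - x) ≤ 1 := Real.sqrt_le_one.2 (by linarith)
    have e2 : z ≤ √(x * h) := Real.sqrt_le_sqrt (by nlinarith only [hx0, h0])
    linarith
  have hlz : Real.log z = - Real.log (v / γ) / 2 := by
    rw [hz, Real.log_sqrt hx0.le, hx, ← inv_div v γ, Real.log_inv]
  have hlz1 : Real.log (v / γ) ≥ 3 * Real.log 2 := by
    have : Real.log (2 ^ 3) ≤ Real.log (v / γ) := by
      refine Real.log_le_log (by norm_num) ?_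
      rw [le_div_iff₀ hγ]; nlinarith
    rwa [Real.log_pow] at this
  set P := 1 - Real.log z with hP
  have hP2 : 2.039 ≤ P := by rw [hP, hlz]; linarith
  have hPD : P ≤ D := by rw [hP, hlz]; nlinarith only [hD, hd, hlz1, hl3]
  have hX : d / 2 * Real.log (γ / (s * 2 ^ 2 * (1 / 8))) + Real.log (1 / (1 / 8)) / 2 ≤ 1.03973 := by
    have e1 : Real.log (γ / (s * 2 ^ 2 * (1 / 8))) ≤ 0 := by
      refine Real.log_nonpos (by positivity) ?_
      rw [div_le_one (by positivity)]; nlinarith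
    have e2 : Real.log (1 / (1 / 8)) = 3 * Real.log 2 := by
      rw [show (1 : ℝ) / (1 / 8) = 2 ^ 3 by norm_num, Real.log_pow]; norm_num
    rw [e2]
    nlinarith only [e1, hd, hl2]
  have hR : 1.03973 / P ≤ 0.51 := by rw [div_le_iff₀ (by linarith)]; linarith
  have hR0 : 0 ≤ 1.03973 / P := div_nonneg (by norm_num) (by linarith)
  have hlam : 1.06905 * (1 - z) * (1 + 1.03973 / P) ≤ 2 :=
    (mul_le_mul (show 1.06905 * (1 - z) ≤ 1.07 by linarith)
      (show 1 + 1.03973 / P ≤ 1.51 by linarith) (by linarith) (by norm_num)).trans (by norm_num)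
  have hslack : 0 ≤ c * √D * (1 - 1.06905 * (1 - z) * (1 + 1.03973 / P) / 2) :=
    mul_nonneg (by positivity) (by linarith)
  have hq : 1.4142 ≤ √(2 : ℝ) := Real.le_sqrt_of_sq_le (by norm_num)
  refine radius_two_of_balance (lam := 1.06905 * (1 - z)) (R := 1 + 1.03973 / P) hc ha h1 h2 hs hH0
    ?_ (by norm_num) ?_ (by linarith) ?_ ?_
  · have : 1 / 1.06905 ≤ √(1 - 1 / 8 : ℝ) := Real.le_sqrt_of_sq_le (by norm_num)
    rw [div_le_iff₀ (by norm_num)] at this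
    nlinarith only [this, hHz, hz1]
  · have : 1.03973 ≤ D * (1.03973 / P) := by
      rw [mul_div_assoc', le_div_iff₀ (by linarith)]; linarith
    linarith
  · have e2 := mul_nonneg (show 0 ≤ √(2:ℝ) by positivity) hslack
    have e3 : 1.06905 * (1 - z) * (1 + (1 + 1.03973 / P)) ≤ 1.06905 * 2.51 :=
      mul_le_mul (by linarith) (by linarith) (by linarith) (by norm_num)
    linarith
  · have := one_sub_mul_le_of_log hz0 hz1
    rw [← hP] at this
    have e : (1.06905 : ℝ) * (1 - z) * (2 + (1 + 1.03973 / P)) = 1.06905 * (1 - z) * (3 + 1.03973 / P) := by ring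
    rw [e]; linarith

theorem exists_radius_multiplier_two_of_lt_one {d c γ v D a A s h H : ℝ} (hd : 1 ≤ d)
    (hc : 2 / 3 ≤ c) (hγ : 0 < γ) (h0 : 0 < h)
    (hH : H = √(1 - γ / v) - √(γ / v * h)) (hH0 : 0 < H)
    (hD : 1 + d / 2 * Real.log (v / γ) ≤ D) (ha : 0 < a) (h1 : a ^ 2 ≤ D) (h2 : D ≤ 2 * a ^ 2)
    (hs : 1 ≤ s) (hsγ : γ * (1 + h) ≤ s) (hvs : 4 * s < v) :
    ∃ y, 0 < y ∧ y < 1 ∧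
      H * (a * 2 ^ 2 / 2 + (D + (d / 2 * Real.log (γ / (s * 2 ^ 2 * y)) + Real.log (1 / y) / 2)) *
        (1 / a + c / √s)) ≤ 2 * √(1 - y) * (c * D + D / a + max A √(D / 2)) := by
  have hl2 := Real.log_two_lt_d9
  have hl3 := Real.log_two_gt_d9
  -- With `y = 1/5`, the correction is at most `(d/2) log(5/4) + (log 5)/2`.
  refine ⟨1 / 5, by norm_num, by norm_num, ?_⟩
  have hv0 : 0 < v := by linarith
  have hγs : γ ≤ s := by nlinarith
  set x := γ / v with hx
  have hx0 : 0 < x := div_pos hγ hv0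
  have hx1 : x ≤ 1 / 4 := by
    rw [hx, div_le_iff₀ hv0]; linarith
  have hHx : H ≤ √(1 - x) := by
    have := Real.sqrt_nonneg (x * h); linarith
  have hl5 : Real.log 5 ≤ 7 / 3 * Real.log 2 := by
    have : Real.log (5 ^ 3) ≤ Real.log (2 ^ 7) := Real.log_le_log (by norm_num) (by norm_num)
    rw [Real.log_pow, Real.log_pow] at this
    norm_num at this
    linarith
  have hX : d / 2 * Real.log (γ / (s * 2 ^ 2 * (1 / 5))) + Real.log (1 / (1 / 5)) / 2 ≤
      d * 0.1156 + 0.8087 := by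
    have e1 : Real.log (γ / (s * 2 ^ 2 * (1 / 5))) ≤ Real.log 5 - 2 * Real.log 2 := by
      have : Real.log 5 - 2 * Real.log 2 = Real.log (5 / 2 ^ 2) := by
        rw [Real.log_div (by norm_num) (by norm_num), Real.log_pow]; norm_num
      rw [this]
      refine Real.log_le_log (by positivity) ?_
      rw [div_le_div_iff₀ (by positivity) (by norm_num)]; linarith
    have e2 : Real.log (1 / (1 / 5)) = Real.log 5 := by norm_num
    rw [e2]
    nlinarith
  have hq : 1.4142 ≤ √(2 : ℝ) := Real.le_sqrt_of_sq_le (by norm_num)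
  -- On a range of `x`, `p` bounds `1 + log(v/γ)/2` below, `lam` bounds `√(1-x)/√0.8` above and `q`
  -- bounds `√p` below. The numerator `0.9243` is the correction at `d = 1`, the worst dimension
  -- relative to `D ≥ 1 + d(p-1)`.
  have piece : ∀ p lam q : ℝ, 1.69 ≤ p → 2 * (p - 1) ≤ Real.log (v / γ) → 1 - x ≤ lam ^ 2 * 0.8 →
      0 ≤ lam → lam ≤ 1.12 → 0 ≤ q → q ^ 2 ≤ p → lam * (1 + 0.9243 / p) ≤ 1.7 →
      lam * (3 + 0.9243 / p) ≤ 3.4142 + 4 / 3 * (q * (1 - lam * (1 + 0.9243 / p) / 2)) →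
      H * (a * 2 ^ 2 / 2 + (D + (d / 2 * Real.log (γ / (s * 2 ^ 2 * (1 / 5))) +
        Real.log (1 / (1 / 5)) / 2)) * (1 / a + c / √s)) ≤
        2 * √(1 - 1 / 5) * (c * D + D / a + max A √(D / 2)) := by
    intro p lam q hp hpl hlam hlam0 hlam1 hq0 hqp hR hfin
    have hp0 : 0 < p := by linarith
    have hDp : 1 + d * (p - 1) ≤ D := by nlinarith
    have hqD : q ≤ √D := Real.le_sqrt_of_sq_le (by nlinarith)
    have hr : 0 ≤ 0.9243 / p := by positivity
    have hslack : q * (1 - lam * (1 + 0.9243 / p) / 2) * (2 / 3) ≤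
        c * √D * (1 - lam * (1 + 0.9243 / p) / 2) := by
      have : q * (2 / 3) ≤ c * √D := by
        rw [mul_comm]
        exact mul_le_mul hc hqD hq0 (by linarith)
      have := mul_le_mul_of_nonneg_right this (show 0 ≤ 1 - lam * (1 + 0.9243 / p) / 2 by linarith)
      linarith
    have hslack0 : 0 ≤ q * (1 - lam * (1 + 0.9243 / p) / 2) := mul_nonneg hq0 (by linarith)
    refine radius_two_of_balance (lam := lam) (R := 1 + 0.9243 / p) (by linarith) ha h1 h2 hs hH0
      ?_ (by norm_num) ?_ (by linarith) ?_ ?_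
    · refine hHx.trans (Real.sqrt_le_iff.2 ⟨by positivity, ?_⟩)
      rw [mul_pow, Real.sq_sqrt (by norm_num)]
      linarith
    · have : d * 0.1156 + 0.8087 ≤ D * (0.9243 / p) := by
        rw [mul_div_assoc', le_div_iff₀ hp0]
        nlinarith
      linarith
    · have e2 := mul_nonneg (show 0 ≤ √(2:ℝ) by positivity) (show 0 ≤ c * √D * (1 - lam * (1 + 0.9243 / p) / 2) by linarith)
      linarith
    · linarith
  have hlog : ∀ m : ℕ, x ≤ 1 / 2 ^ m → m * Real.log 2 ≤ Real.log (v / γ) := by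
    intro m hm
    rw [← Real.log_pow]
    refine Real.log_le_log (by positivity) ?_
    rw [hx, div_le_div_iff₀ hv0 (by positivity)] at hm
    rw [le_div_iff₀ hγ]; linarith
  rcases le_total x (1 / 8) with hx2 | hx2
  · rcases le_total x (1 / 16) with hx3 | hx3
    · have := hlog 4 (by norm_num; linarith)
      norm_num at this
      refine piece 2.386 1.1181 1.54 ?_ ?_ ?_ ?_ ?_ ?_ ?_ ?_ ?_ <;> (norm_num; try linarith)
    · have := hlog 3 (by norm_num; linarith)
      norm_num at this
      refine piece 2.039 1.0826 1.427 ?_ ?_ ?_ ?_ ?_ ?_ ?_ ?_ ?_ <;> (norm_num; try linarith)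
  · have := hlog 2 (by norm_num; linarith)
    norm_num at this
    refine piece 1.693 1.0459 1.301 ?_ ?_ ?_ ?_ ?_ ?_ ?_ ?_ ?_ <;> (norm_num; try linarith)

/-- Positivity of `H` forces `v > γ(1+h)`, hence `v ≥ s`. If `v > 4s`, the choice `K = 2` suffices,
treated according to whether `h ≥ 1`; `h < 1` means `c > 2/3`. -/
theorem exists_radius_multiplier {d c γ v D a A s h H : ℝ} (hd : 1 ≤ d) (hc : 0 < c)
    (hγ : 0 < γ) (hv : 1 ≤ v) (hh : h = 2 / (c + √(c ^ 2 + 2 * c)))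
    (hH : H = √(1 - γ / v) - √(γ / v * h)) (hH0 : 0 < H)
    (hD : 1 + d / 2 * Real.log (v / γ) ≤ D) (ha : 0 < a) (h1 : a ^ 2 ≤ D) (h2 : D ≤ 2 * a ^ 2)
    (hA : c / γ ≤ A) (hs : s = max 1 (γ * (1 + h))) :
    ∃ K y, 0 < K ∧ K ^ 2 * s ≤ v ∧ 0 < y ∧ y < 1 ∧
      H * (a * K ^ 2 / 2 + (D + (d / 2 * Real.log (γ / (s * K ^ 2 * y)) + Real.log (1 / y) / 2)) *
        (1 / a + c / √s)) ≤ K * √(1 - y) * (c * D + D / a + max A √(D / 2)) := by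
  have hv0 : 0 < v := by linarith
  set q := √(c ^ 2 + 2 * c) with hq
  have hq0 : 0 < q := Real.sqrt_pos.2 (by positivity)
  have hq2 : q ^ 2 = c ^ 2 + 2 * c := Real.sq_sqrt (by positivity)
  have hh0 : 0 < h := by rw [hh]; positivity
  have hq1 : q ≤ c + 1 := by
    by_contra hcon; push Not at hcon; nlinarith
  have hs1 : 1 ≤ s := by rw [hs]; exact le_max_left _ _
  have hs2 : γ * (1 + h) ≤ s := by rw [hs]; exact le_max_right _ _
  rcases le_or_gt v (4 * s) with hvs | hvs
  · refine exists_radius_multiplier_of_le_four hd hc hγ hv hh0 ?_ hH hH0 hD ha h1 h2 hA hs1 ?_ hvs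
    · rw [hh, one_div_div]; linarith
    · rw [hs]
      refine max_le hv ?_
      have : √(γ / v * h) < √(1 - γ / v) := by linarith
      have := (Real.sqrt_lt_sqrt_iff (by positivity)).1 this
      have e : γ * (1 + h) = (γ / v * h + γ / v) * v := by field_simp; ring
      rw [e]
      nlinarith
  · have : ∃ y, 0 < y ∧ y < 1 ∧
      H * (a * 2 ^ 2 / 2 + (D + (d / 2 * Real.log (γ / (s * 2 ^ 2 * y)) + Real.log (1 / y) / 2)) *
        (1 / a + c / √s)) ≤ 2 * √(1 - y) * (c * D + D / a + max A √(D / 2)) := by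
      rcases le_or_gt 1 h with h3 | h3
      · exact exists_radius_multiplier_two_of_one_le hd hc hγ h3 hH hH0 hD ha h1 h2 hs1 hs2 hvs
      · refine exists_radius_multiplier_two_of_lt_one hd ?_ hγ hh0 hH hH0 hD ha h1 h2 hs1 hs2 hvs
        rw [hh, div_lt_one (by positivity)] at h3
        by_contra hcon; push Not at hcon; nlinarith
    obtain ⟨y, hy⟩ := this
    exact ⟨2, y, by norm_num, by linarith, hy⟩

end RadiusMultiplier

/-! ### Extreme eigenvalues, determinants and the Loewner order -/

section ExtremeEigenvalues

variable {d : ℕ} {A B : Matrix (Fin d) (Fin d) ℝ}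

theorem Matrix.IsHermitian.gammaMin_le (hA : A.IsHermitian) {r : ℝ} (hr : r ∈ spectrum ℝ A) :
    gammaMin A ≤ r := by
  rw [hA.spectrum_real_eq_range_eigenvalues] at hr
  rw [gammaMin, hA.spectrum_real_eq_range_eigenvalues]
  exact csInf_le (Set.finite_range _).bddBelow hr

theorem Matrix.IsHermitian.le_gammaMax (hA : A.IsHermitian) {r : ℝ} (hr : r ∈ spectrum ℝ A) :
    r ≤ gammaMax A := by
  rw [hA.spectrum_real_eq_range_eigenvalues] at hr
  rw [gammaMax, hA.spectrum_real_eq_range_eigenvalues]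
  exact le_csSup (Set.finite_range _).bddAbove hr

theorem Matrix.IsHermitian.gammaMin_mem (hA : A.IsHermitian) (hd : 0 < d) :
    gammaMin A ∈ spectrum ℝ A := by
  have : Nonempty (Fin d) := ⟨⟨0, hd⟩⟩
  rw [gammaMin, hA.spectrum_real_eq_range_eigenvalues]
  exact (Set.range_nonempty _).csInf_mem (Set.finite_range _)

theorem Matrix.PosDef.gammaMin_pos (hA : A.PosDef) (hd : 0 < d) : 0 < gammaMin A := by
  have := hA.isHermitian.gammaMin_mem hd
  rw [hA.isHermitian.spectrum_real_eq_range_eigenvalues] at this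
  obtain ⟨i, hi⟩ := this
  rw [← hi]
  exact hA.eigenvalues_pos i

theorem Matrix.PosDef.gammaMin_le_gammaMax (hA : A.PosDef) (hd : 0 < d) :
    gammaMin A ≤ gammaMax A :=
  hA.isHermitian.le_gammaMax (hA.isHermitian.gammaMin_mem hd)

theorem Matrix.PosDef.gammaMin_pow_le_det (hA : A.PosDef) (hd : 0 < d) :
    gammaMin A ^ d ≤ A.det := by
  rw [hA.isHermitian.det_eq_prod_eigenvalues]
  calc gammaMin A ^ d = ∏ _i : Fin d, gammaMin A := by simp
    _ ≤ _ := Finset.prod_le_prod (fun _ _ => (hA.gammaMin_pos hd).le) fun i _ =>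
      hA.isHermitian.gammaMin_le (hA.isHermitian.eigenvalues_mem_spectrum_real i)

theorem Matrix.PosDef.det_le_gammaMax_pow (hA : A.PosDef) :
    A.det ≤ gammaMax A ^ d := by
  rw [hA.isHermitian.det_eq_prod_eigenvalues]
  calc _ ≤ ∏ _i : Fin d, gammaMax A :=
        Finset.prod_le_prod (fun i _ => (hA.eigenvalues_pos i).le) fun i _ =>
          hA.isHermitian.le_gammaMax (hA.isHermitian.eigenvalues_mem_spectrum_real i)
    _ = _ := by simp

theorem Matrix.IsHermitian.gammaMin_mul_sq_norm_le (hA : A.IsHermitian)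
    (u : EuclideanSpace ℝ (Fin d)) : gammaMin A * ‖u‖ ^ 2 ≤ quadForm A u := by
  have hB : (A - algebraMap ℝ (Matrix (Fin d) (Fin d) ℝ) (gammaMin A)).IsHermitian := by
    refine hA.sub ?_
    rw [Matrix.algebraMap_eq_diagonal]
    exact Matrix.isHermitian_diagonal _
  have hpsd : (A - algebraMap ℝ (Matrix (Fin d) (Fin d) ℝ) (gammaMin A)).PosSemidef := by
    rw [hB.posSemidef_iff_eigenvalues_nonneg]
    intro i
    have h1 := hB.eigenvalues_mem_spectrum_real i
    rw [← spectrum.sub_singleton_eq] at h1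
    obtain ⟨r, hr, s, hs, h2⟩ := Set.mem_sub.1 h1
    rw [Set.mem_singleton_iff] at hs
    have := hA.gammaMin_le hr
    simp only [Pi.zero_apply]
    linarith
  have := hpsd.dotProduct_mulVec_nonneg u.ofLp
  rw [Matrix.sub_mulVec, dotProduct_sub, Algebra.algebraMap_eq_smul_one, Matrix.smul_mulVec,
    Matrix.one_mulVec, dotProduct_smul] at this
  have e : u.ofLp ⬝ᵥ u.ofLp = ‖u‖ ^ 2 := by
    rw [EuclideanSpace.real_norm_sq_eq]
    simp [dotProduct, sq]
  simp only [star_trivial, e, smul_eq_mul] at this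
  rw [quadForm]
  linarith

theorem LoewnerGE.one_le_gammaMin (hA : A.IsHermitian) (hd : 0 < d) (h : LoewnerGE A 1) :
    1 ≤ gammaMin A := by
  have h1 : gammaMin A - 1 ∈ spectrum ℝ (A - 1) := by
    have := spectrum.sub_singleton_eq A (1 : ℝ)
    rw [map_one] at this
    rw [← this]
    exact Set.sub_mem_sub (hA.gammaMin_mem hd) rfl
  rw [Matrix.IsHermitian.spectrum_real_eq_range_eigenvalues h.isHermitian] at h1
  obtain ⟨i, hi⟩ := h1
  have := Matrix.PosSemidef.eigenvalues_nonneg h i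
  linarith

theorem LoewnerGE.trans {C : Matrix (Fin d) (Fin d) ℝ} (h1 : LoewnerGE A B) (h2 : LoewnerGE B C) :
    LoewnerGE A C := by
  have := Matrix.PosSemidef.add h1 h2
  rwa [sub_add_sub_cancel] at this

end ExtremeEigenvalues

/-! ### From a bounded mixture integral to a bound on the weighted norm -/

theorem quadForm_div_le {d : ℕ} {c q : ℝ} (hc : 0 < c) (hq : c * q < 1)
    {A : Matrix (Fin d) (Fin d) ℝ} (hA : A.PosDef) {u : EuclideanSpace ℝ (Fin d)} (hu : ‖u‖ < q) :
    quadForm A u / (2 * (1 - c * ‖u‖)) ≤ 1 / (2 * (1 - c * q)) * quadForm A u := by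
  have h0 : 0 ≤ quadForm A u := by
    have := hA.posSemidef.dotProduct_mulVec_nonneg u.ofLp
    simpa [quadForm] using this
  have : c * ‖u‖ ≤ c * q := by gcongr
  rw [div_eq_inv_mul, one_div]
  have h1 : 0 < 2 * (1 - c * q) := by linarith
  gcongr

/-- The logarithm of the ellipsoid lower bound for the mixture. The condition on `Υ` places the
ellipsoid inside the ball of radius `q`. -/
theorem mul_weightedNorm_le_of_lintegral_le {d : ℕ} (hd : 0 < d) {c q l δ Υ σ : ℝ} (hc : 0 < c)
    (hq0 : 0 < q) (hq : c * q < 1) (hl : 0 < l) (hδ : 0 < δ)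
    {V : Matrix (Fin d) (Fin d) ℝ} (hV : V.PosDef) {S : EuclideanSpace ℝ (Fin d)}
    (hmix : ENNReal.ofReal (1 / l) * ((volume (Metric.ball (0 : EuclideanSpace ℝ (Fin d)) q))⁻¹ *
      ∫⁻ u in Metric.ball 0 q, ENNReal.ofReal (subGammaWeight c S V u)) ≤ ENNReal.ofReal (1 / δ))
    (hΥ : 0 < Υ) (hincl : Υ ^ 2 ≤ gammaMin V * q ^ 2) (hσ0 : 0 ≤ σ) (hσ : σ < 1) :
    Υ * weightedNorm V⁻¹ S * σ ≤ Υ ^ 2 / (2 * (1 - c * q)) + d * Real.log (q / Υ) +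
      Real.log V.det / 2 + (d + 1) / 2 * Real.log (1 / (1 - σ ^ 2)) + 1 + Real.log l +
      Real.log (1 / δ) := by
  have hκ : 0 < 1 / (2 * (1 - c * q)) := by
    have : 0 < 1 - c * q := by linarith
    positivity
  have hv : 0 < gammaMin V := hV.gammaMin_pos hd
  have hincl' : ∀ u : EuclideanSpace ℝ (Fin d), quadForm V u < Υ ^ 2 → ‖u‖ < q := by
    intro u hu
    have h1 := hV.isHermitian.gammaMin_mul_sq_norm_le u
    have h2 : ‖u‖ ^ 2 < q ^ 2 := lt_of_mul_lt_mul_left (by linarith) hv.le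
    exact lt_of_pow_lt_pow_left₀ 2 hq0.le h2
  have h1 := ellipsoid_mul_volume_le_lintegral_ball hd hV S hΥ hκ.le hincl' hσ0 hσ
  have h2 : ∫⁻ u in Metric.ball (0 : EuclideanSpace ℝ (Fin d)) q,
      ENNReal.ofReal (Real.exp (inner ℝ u S - 1 / (2 * (1 - c * q)) * quadForm V u)) ≤
      ∫⁻ u in Metric.ball 0 q, ENNReal.ofReal (subGammaWeight c S V u) := by
    refine setLIntegral_mono' measurableSet_ball fun u hu => ?_
    refine ENNReal.ofReal_le_ofReal (Real.exp_le_exp.2 ?_)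
    have := quadForm_div_le hc hq hV (u := u) (by simpa using hu)
    linarith
  set G := Υ ^ d / √V.det * (Real.exp (-(1 / (2 * (1 - c * q)) * Υ ^ 2)) *
    (Real.exp (Υ * weightedNorm V⁻¹ S * σ - 1) * √(1 - σ ^ 2) ^ (d + 1))) with hG
  have hdet : 0 < V.det := hV.det_pos
  have hσ2 : 0 < 1 - σ ^ 2 := by nlinarith
  have hG0 : 0 < G := by
    have := Real.sqrt_pos.2 hσ2
    have := Real.sqrt_pos.2 hdet
    positivity
  have hB0 : volume (Metric.ball (0 : EuclideanSpace ℝ (Fin d)) 1) ≠ 0 :=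
    (Metric.measure_ball_pos _ _ one_pos).ne'
  have hB1 : volume (Metric.ball (0 : EuclideanSpace ℝ (Fin d)) 1) ≠ ∞ := measure_ball_lt_top.ne
  have hvol : volume (Metric.ball (0 : EuclideanSpace ℝ (Fin d)) q) =
      ENNReal.ofReal (q ^ d) * volume (Metric.ball (0 : EuclideanSpace ℝ (Fin d)) 1) := by
    rw [Measure.addHaar_ball_of_pos _ _ hq0, finrank_euclideanSpace_fin]
  have h3 : ENNReal.ofReal (1 / l * ((q ^ d)⁻¹ * G)) ≤ ENNReal.ofReal (1 / δ) := by
    refine le_trans ?_ hmix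
    rw [ENNReal.ofReal_mul (by positivity), ENNReal.ofReal_mul (by positivity), hvol,
      ENNReal.mul_inv (Or.inr hB1) (Or.inr hB0), ENNReal.ofReal_inv_of_pos (by positivity)]
    rw [mul_assoc (ENNReal.ofReal (q ^ d))⁻¹]
    gcongr
    calc ENNReal.ofReal G = (volume (Metric.ball (0 : EuclideanSpace ℝ (Fin d)) 1))⁻¹ *
          (ENNReal.ofReal G * volume (Metric.ball (0 : EuclideanSpace ℝ (Fin d)) 1)) := by
          rw [mul_comm (ENNReal.ofReal G), ← mul_assoc, ENNReal.inv_mul_cancel hB0 hB1, one_mul]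
      _ ≤ _ := by gcongr; exact h1.trans h2
  rw [ENNReal.ofReal_le_ofReal_iff (by positivity)] at h3
  have h4 := Real.log_le_log (by positivity) h3
  have hs1 := (Real.sqrt_pos.2 hσ2).ne'
  have hs2 := (Real.sqrt_pos.2 hdet).ne'
  have e : Real.log (1 / l * ((q ^ d)⁻¹ * G)) = - Real.log l - d * Real.log q + (d * Real.log Υ -
      Real.log V.det / 2 + (-(1 / (2 * (1 - c * q)) * Υ ^ 2) + ((Υ * weightedNorm V⁻¹ S * σ - 1) +
        (d + 1) * (Real.log (1 - σ ^ 2) / 2)))) := by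
    rw [Real.log_mul (by positivity) (by positivity), Real.log_mul (by positivity) hG0.ne', hG,
      Real.log_mul (by positivity) (by positivity), Real.log_mul (by positivity) (by positivity),
      Real.log_mul (by positivity) (by positivity), Real.log_div (by positivity) hs2,
      Real.log_exp, Real.log_exp, Real.log_pow, Real.log_pow, Real.log_sqrt hσ2.le,
      Real.log_sqrt hdet.le, one_div, Real.log_inv, Real.log_inv, Real.log_pow]
    push_cast
    ring
  rw [e] at h4
  rw [Real.log_div hq0.ne' hΥ.ne', one_div (1 - σ ^ 2), Real.log_inv (1 - σ ^ 2)]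
  have e3 : Υ ^ 2 / (2 * (1 - c * q)) = 1 / (2 * (1 - c * q)) * Υ ^ 2 := by ring
  rw [e3]
  linarith

section DeterministicBound

variable {d : ℕ} {c : ℝ} {U V : Matrix (Fin d) (Fin d) ℝ}

theorem gammaMax_lt_gammaMin_of_hFactor_ne_zero (hV : 0 < gammaMin V)
    (hH : hFactor c U V ≠ 0) : gammaMax U < gammaMin V := by
  by_contra h
  push Not at h
  refine hH (max_eq_left ?_)
  rw [Real.sqrt_eq_zero_of_nonpos]
  · have := Real.sqrt_nonneg (gammaMax U / gammaMin V * (2 / (c + √(c ^ 2 + 2 * c))))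
    linarith
  · rw [sub_nonpos, le_div_iff₀ hV]; linarith

theorem mul_log_gammaMin_div_gammaMax_le (hd : 0 < d) (hU : U.PosDef) (hV : V.PosDef) :
    d * Real.log (gammaMin V / gammaMax U) ≤ Real.log (V.det / U.det) := by
  have hU0 := (hU.gammaMin_pos hd).trans_le (hU.gammaMin_le_gammaMax hd)
  have hV0 := hV.gammaMin_pos hd
  have hdU := hU.det_pos
  have hdV := hV.det_pos.le
  rw [← Real.log_pow, div_pow]
  refine Real.log_le_log (by positivity) ?_
  have h1 := hV.gammaMin_pow_le_det hd
  have h2 := hU.det_le_gammaMax_pow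
  gcongr

theorem div_gammaMax_le (hd : 0 < d) (hc : 0 < c) (hU : U.PosDef) :
    c / gammaMax U ≤ (c + √(c ^ 2 + 2 * gammaMin U)) / (2 * gammaMin U) := by
  have h1 := hU.gammaMin_pos hd
  have h2 := hU.gammaMin_le_gammaMax hd
  have h3 : c ≤ √(c ^ 2 + 2 * gammaMin U) := Real.le_sqrt_of_sq_le (by linarith)
  calc c / gammaMax U ≤ c / gammaMin U := by gcongr
    _ = (c + c) / (2 * gammaMin U) := by field_simp; ring
    _ ≤ _ := by gcongr

/-- The bound at a fixed time, for an epoch whose mixture integral is at most `1 / δ`. -/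
theorem weightedNorm_le_of_lintegral_le (hd : 0 < d) (hc : 0 < c) (hU : U.PosDef) (hV : V.PosDef)
    (hV1 : LoewnerGE V 1) {S : EuclideanSpace ℝ (Fin d)} {l δ a s q D : ℝ} (hl : 1 ≤ l)
    (hδ0 : 0 < δ) (hδ1 : δ < 1) (hH : hFactor c U V ≠ 0)
    (hs : s = max 1 (gammaMax U * (1 + 2 / (c + √(c ^ 2 + 2 * c)))))
    (hD : D = 1 / 2 * Real.log (V.det / U.det) + 1 + Real.log l + Real.log (1 / δ))
    (ha : 0 < a) (h1 : a ^ 2 ≤ D) (h2 : D ≤ 2 * a ^ 2)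
    (hq : q = a / √s / (1 + c * (a / √s)))
    (hmix : ENNReal.ofReal (1 / l) * ((volume (Metric.ball (0 : EuclideanSpace ℝ (Fin d)) q))⁻¹ *
      ∫⁻ u in Metric.ball 0 q, ENNReal.ofReal (subGammaWeight c S V u)) ≤ ENNReal.ofReal (1 / δ)) :
    weightedNorm V⁻¹ S ≤ (c * D + D / a + maxTerm c (gammaMin U) D) / hFactor c U V := by
  have hγ0 : 0 < gammaMax U := (hU.gammaMin_pos hd).trans_le (hU.gammaMin_le_gammaMax hd)
  have hv1 : 1 ≤ gammaMin V := hV1.one_le_gammaMin hV.isHermitian hd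
  have hv0 : 0 < gammaMin V := by linarith
  have hHpos : 0 < hFactor c U V := lt_of_le_of_ne (le_max_left _ _) hH.symm
  have hHeq : hFactor c U V = √(1 - gammaMax U / gammaMin V) -
      √(gammaMax U / gammaMin V * (2 / (c + √(c ^ 2 + 2 * c)))) := by
    rw [hFactor] at hHpos ⊢
    rcases le_total (√(1 - gammaMax U / gammaMin V) -
      √(gammaMax U / gammaMin V * (2 / (c + √(c ^ 2 + 2 * c))))) 0 with h | h
    · rw [max_eq_left h] at hHpos; exact absurd hHpos (lt_irrefl _)
    · exact max_eq_right h
  have hdl := mul_log_gammaMin_div_gammaMax_le hd hU hV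
  have hl0 := Real.log_nonneg hl
  have hδl : 0 ≤ Real.log (1 / δ) := Real.log_nonneg ((one_le_div hδ0).2 hδ1.le)
  have hs0 : 0 < s := by rw [hs]; exact lt_max_of_lt_left one_pos
  obtain ⟨K, y, hK, hKs, hy0, hy1, hbal⟩ := exists_radius_multiplier (d := d) (γ := gammaMax U)
    (v := gammaMin V) (D := D) (A := (c + √(c ^ 2 + 2 * gammaMin U)) / (2 * gammaMin U))
    (by exact_mod_cast hd) hc hγ0 hv1 rfl hHeq hHpos (by linarith) ha h1 h2
    (div_gammaMax_le hd hc hU) hs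
  have hss : √s ^ 2 = s := Real.sq_sqrt hs0.le
  have hss0 : 0 < √s := Real.sqrt_pos.2 hs0
  set b := a / √s with hb
  have hb0 : 0 < b := by positivity
  have hab : a = b * √s := by rw [hb]; field_simp
  have hq0 : 0 < q := by rw [hq]; positivity
  have hcq : 1 - c * q = 1 / (1 + c * b) := by rw [hq]; field_simp; ring
  have hcq1 : c * q < 1 := by
    have : 0 < 1 / (1 + c * b) := by positivity
    linarith
  -- The form `q = b/(1+cb)` gives `1 - cq = 1/(1+cb)` and `1/q = 1/b + c`. The first turns the
  -- quadratic term into `Υ a K/2`, the second yields the factor `1/a + c/√s`.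
  set Υ := q * √s * K with hΥ
  have hΥ0 : 0 < Υ := by positivity
  have hΥ2 : Υ ^ 2 ≤ gammaMin V * q ^ 2 := by
    have : Υ ^ 2 = K ^ 2 * s * q ^ 2 := by rw [hΥ, mul_pow, mul_pow, hss]; ring
    rw [this]; gcongr
  have hσ1 : √(1 - y) < 1 := by
    rw [Real.sqrt_lt' one_pos]; linarith
  have hσ0 : 0 < √(1 - y) := Real.sqrt_pos.2 (by linarith)
  have hN := mul_weightedNorm_le_of_lintegral_le hd hc hq0 hcq1 (by linarith) hδ0 hV hmix hΥ0 hΥ2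
    hσ0.le hσ1
  rw [Real.sq_sqrt (by linarith), sub_sub_cancel] at hN
  set X := d / 2 * Real.log (gammaMax U / (s * K ^ 2 * y)) + Real.log (1 / y) / 2 with hX
  have hlogs : d * Real.log (q / Υ) + Real.log V.det / 2 + (d + 1) / 2 * Real.log (1 / y) + 1 +
      Real.log l + Real.log (1 / δ) ≤ D + X := by
    have e1 : Real.log (q / Υ) = -(Real.log s / 2) - Real.log K := by
      rw [hΥ, Real.log_div hq0.ne' hΥ0.ne', Real.log_mul (by positivity) hK.ne',
        Real.log_mul hq0.ne' hss0.ne', Real.log_sqrt hs0.le]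
      ring
    have e2 : Real.log (1 / y) = - Real.log y := by rw [one_div, Real.log_inv]
    have e3 : Real.log (gammaMax U / (s * K ^ 2 * y)) =
        Real.log (gammaMax U) - (Real.log s + 2 * Real.log K + Real.log y) := by
      rw [Real.log_div hγ0.ne' (by positivity), Real.log_mul (by positivity) hy0.ne',
        Real.log_mul hs0.ne' (by positivity), Real.log_pow]
      push_cast; ring
    have e4 : Real.log (V.det / U.det) = Real.log V.det - Real.log U.det :=
      Real.log_div hV.det_pos.ne' hU.det_pos.ne'
    have e5 : Real.log U.det ≤ d * Real.log (gammaMax U) := by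
      rw [← Real.log_pow]
      exact Real.log_le_log hU.det_pos hU.det_le_gammaMax_pow
    rw [hX, hD, e1, e2, e3, e4]
    linarith
  have hquad : Υ ^ 2 / (2 * (1 - c * q)) = Υ * (a * K / 2) := by
    rw [hcq, hΥ, hab, hq]; field_simp
  have hrad : K * (D + X) = Υ * ((D + X) * (1 / a + c / √s)) := by
    rw [hΥ, hab, hq]; field_simp
  have hmain : K * √(1 - y) * weightedNorm V⁻¹ S ≤
      a * K ^ 2 / 2 + (D + X) * (1 / a + c / √s) := by
    refine le_of_mul_le_mul_left ?_ hΥ0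
    calc Υ * (K * √(1 - y) * weightedNorm V⁻¹ S)
        = K * (Υ * weightedNorm V⁻¹ S * √(1 - y)) := by ring
      _ ≤ K * (Υ ^ 2 / (2 * (1 - c * q)) + (D + X)) := by gcongr; linarith
      _ = Υ * (a * K ^ 2 / 2 + (D + X) * (1 / a + c / √s)) := by
          rw [mul_add, hrad, hquad]; ring
  rw [le_div_iff₀ hHpos]
  refine le_of_mul_le_mul_left ?_ (mul_pos hK hσ0)
  calc K * √(1 - y) * (weightedNorm V⁻¹ S * hFactor c U V)
      = hFactor c U V * (K * √(1 - y) * weightedNorm V⁻¹ S) := by ring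
    _ ≤ hFactor c U V * (a * K ^ 2 / 2 + (D + X) * (1 / a + c / √s)) := by gcongr
    _ ≤ _ := hbal

end DeterministicBound

/-! ### The event on which every epoch is controlled -/

section GoodEvent

variable {Ω : Type*} [m : MeasurableSpace Ω] {μ : Measure Ω} [IsProbabilityMeasure μ]
  {ℱ : Filtration ℕ m} {d : ℕ} {c : ℝ} {S : ℕ → Ω → EuclideanSpace ℝ (Fin d)}
  {V : ℕ → Ω → Matrix (Fin d) (Fin d) ℝ}

theorem IsSubGamma.exists_good_event (hSV : IsSubGamma μ ℱ c S V) (hc : 0 < c) (hd : 0 < d)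
    {ell q : ℕ → ℝ} (hell : ∀ k, 0 < ell k) (hsum : HasSum (fun k => (ell k)⁻¹) 1)
    (hq0 : ∀ k, 0 < q k) (hq : ∀ k, c * q k < 1) {δ : ℝ} (hδ : 0 < δ)
    {P : ℕ → Ω → Prop} (hP : ∀ t, ∀ᵐ ω ∂μ, P t ω) :
    ∃ A : Set Ω, MeasurableSet A ∧ ENNReal.ofReal (1 - δ) ≤ μ A ∧ ∀ ω ∈ A, ∀ t, P t ω ∧
      ∀ k, ENNReal.ofReal (1 / ell k) *
        ((volume (Metric.ball (0 : EuclideanSpace ℝ (Fin d)) (q k)))⁻¹ *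
          ∫⁻ u in Metric.ball 0 (q k), ENNReal.ofReal (subGammaWeight c (S t ω) (V t ω) u)) ≤
        ENNReal.ofReal (1 / δ) := by
  set B : ℕ → Set (EuclideanSpace ℝ (Fin d)) := fun k => Metric.ball 0 (q k) with hB
  -- The mixing law is a probability measure because the `1/ell k` sum to one; keeping only its
  -- `k`-th component gives the bound for epoch `k`.
  set ν : Measure (EuclideanSpace ℝ (Fin d)) := Measure.sum fun k =>
    ENNReal.ofReal (1 / ell k) • (volume (B k))⁻¹ • volume.restrict (B k) with hν
  have hvol0 : ∀ k, volume (B k) ≠ 0 := fun k => (Metric.measure_ball_pos _ _ (hq0 k)).ne'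
  have hvol1 : ∀ k, volume (B k) ≠ ∞ := fun k => measure_ball_lt_top.ne
  have hν1 : ν Set.univ = 1 := by
    rw [hν, Measure.sum_apply _ MeasurableSet.univ]
    have : ∀ k, (ENNReal.ofReal (1 / ell k) • (volume (B k))⁻¹ • volume.restrict (B k)) Set.univ =
        ENNReal.ofReal (1 / ell k) := by
      intro k
      simp only [Measure.smul_apply, Measure.restrict_apply_univ, smul_eq_mul]
      rw [ENNReal.inv_mul_cancel (hvol0 k) (hvol1 k), mul_one]
    simp_rw [this, one_div]
    rw [← ENNReal.ofReal_tsum_of_nonneg (fun k => (inv_pos.2 (hell k)).le) hsum.summable,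
      hsum.tsum_eq, ENNReal.ofReal_one]
  have hνae : ∀ᵐ u ∂ν, ‖u‖ < 1 / c := by
    rw [hν, Measure.ae_sum_iff]
    intro k
    refine Measure.ae_smul_measure (Measure.ae_smul_measure ?_ _) _
    filter_upwards [ae_restrict_mem measurableSet_ball] with u hu
    have hu' : ‖u‖ < q k := by simpa [hB] using hu
    rw [lt_div_iff₀ hc]
    have := hq k
    nlinarith
  have : IsFiniteMeasure ν := ⟨by rw [hν1]; exact ENNReal.one_lt_top⟩
  have hville := hSV.measure_exists_le_lintegral_le hd ν hν1.le hνae hδ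
  set bad : Set Ω := {ω | ∃ t, ENNReal.ofReal (1 / δ) ≤
    ∫⁻ u, ENNReal.ofReal (subGammaWeight c (S t ω) (V t ω) u) ∂ν} ∪ {ω | ¬ ∀ t, P t ω} with hbad
  have hμbad : μ bad ≤ ENNReal.ofReal δ := by
    refine (measure_union_le _ _).trans ?_
    have : μ {ω | ¬ ∀ t, P t ω} = 0 := ae_iff.1 (ae_all_iff.2 hP)
    rw [this, add_zero]
    exact hville
  refine ⟨(toMeasurable μ bad)ᶜ, (measurableSet_toMeasurable μ bad).compl, ?_, ?_⟩
  · rw [prob_compl_eq_one_sub (measurableSet_toMeasurable μ bad), measure_toMeasurable,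
      ENNReal.ofReal_sub _ hδ.le, ENNReal.ofReal_one]
    gcongr
  · intro ω hω t
    have hω' : ω ∉ bad := fun h => hω (subset_toMeasurable μ bad h)
    simp only [hbad, Set.mem_union, Set.mem_ofPred_eq, not_or, not_exists, not_le, not_not] at hω'
    refine ⟨hω'.2 t, fun k => ?_⟩
    refine le_trans ?_ (hω'.1 t).le
    rw [hν, lintegral_sum_measure]
    refine le_trans ?_ (ENNReal.le_tsum k)
    rw [lintegral_smul_measure, lintegral_smul_measure, smul_eq_mul, smul_eq_mul]

end GoodEvent

/-! ### Stitching of epochs and the constants -/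

theorem one_le_of_hasSum_inv {ell : ℕ → ℝ} (hell : ∀ k, 0 < ell k)
    (hsum : HasSum (fun k => (ell k)⁻¹) 1) (k : ℕ) : 1 ≤ ell k := by
  have := le_hasSum hsum k fun j _ => (inv_pos.2 (hell j)).le
  exact (inv_le_one₀ (hell k)).1 this

/-- Otherwise `ell` would be nonincreasing from index one, and its reciprocals could not tend to
zero. -/
theorem one_le_iSup_ratio {ell : ℕ → ℝ} (hell : ∀ k, 0 < ell k)
    (hsum : HasSum (fun k => (ell k)⁻¹) 1)
    (hbdd : BddAbove (Set.range fun k : ℕ => ell (k + 2) / ell (k + 1))) :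
    1 ≤ ⨆ k : ℕ, ell (k + 2) / ell (k + 1) := by
  by_contra h
  push Not at h
  have h1 : ∀ k, ell (k + 1) ≤ ell 1 := by
    intro k
    induction k with
    | zero => exact le_rfl
    | succ k ih =>
      have := (le_ciSup hbdd k).trans h.le
      rw [div_le_one (hell _)] at this
      exact this.trans ih
  have h2 : Tendsto (fun k => (ell (k + 1))⁻¹) atTop (nhds 0) :=
    (tendsto_add_atTop_iff_nat 1).2 hsum.summable.tendsto_atTop_zero
  have h3 : (ell 1)⁻¹ ≤ 0 := ge_of_tendsto' h2 fun k => inv_anti₀ (hell _) (h1 k)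
  exact absurd (inv_pos.2 (hell 1)) (not_lt.2 h3)

/-- The value of `D` attached to the epoch `k` when `log (det V)` equals its lower end `k * r` and
`log (det U) = e`. -/
noncomputable def epochLevel (δ r e : ℝ) (ell : ℕ → ℝ) (k : ℕ) : ℝ :=
  1 / 2 * max 0 (k * r - e) + 1 + Real.log (ell k) + Real.log (1 / δ)

/-- Squaring reduces this to `2D ≤ α E`. Since `2D ≤ 2E + log η`, the lower bound on `E` absorbs
`log η` into the middle term of `α`; the other two terms are together at least `2`. -/
theorem div_sqrt_le_sqrt_alphaConst {δ η D E : ℝ} {ell : ℕ → ℝ} (hη : 1 < η)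
    (hsup : 1 ≤ ⨆ k : ℕ, ell (k + 2) / ell (k + 1))
    (hpos : 0 < 1 + Real.log (1 / δ) - Real.log η / 2)
    (hE : 1 + Real.log (1 / δ) ≤ E) (hDE : D ≤ E + Real.log η / 2) (hD : 0 < D) :
    D / √E ≤ √(alphaConst δ η ell / 2 * D) := by
  have hr : 0 < Real.log η := Real.log_pos hη
  have hE0 : 0 < E := by linarith
  refine Real.le_sqrt_of_sq_le ?_
  rw [div_pow, Real.sq_sqrt hE0.le, div_le_iff₀ hE0]
  have h1 : Real.log η ≤ Real.log η / (1 + Real.log (1 / δ) - Real.log η / 2) * E := by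
    rw [div_mul_eq_mul_div, le_div_iff₀ hpos]
    nlinarith
  have h2 : 2 * D ≤ alphaConst δ η ell * E := by
    rw [alphaConst]; nlinarith
  nlinarith

/-- The time-uniform bound, for any upper estimate `N` of its numerator. -/
theorem stoppedBound_of_general_le {Ω : Type*} [m : MeasurableSpace Ω] {μ : Measure Ω}
    [IsProbabilityMeasure μ] {ℱ : Filtration ℕ m} {d : ℕ} (hd : 0 < d) {c : ℝ} (hc : 0 < c)
    {S : ℕ → Ω → EuclideanSpace ℝ (Fin d)} {V : ℕ → Ω → Matrix (Fin d) (Fin d) ℝ}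
    (hSV : IsSubGamma μ ℱ c S V) {U : Matrix (Fin d) (Fin d) ℝ} (hU : U.PosDef) {t₀ : ℕ}
    (hV1 : ∀ t, t₀ ≤ t → ∀ᵐ ω ∂μ, LoewnerGE (V t ω) 1) {ell : ℕ → ℝ} (hell : ∀ k, 0 < ell k)
    (hsum : HasSum (fun k => (ell k)⁻¹) 1)
    (hbdd : BddAbove (Set.range fun k : ℕ => ell (k + 2) / ell (k + 1)))
    {δ : ℝ} (hδ0 : 0 < δ) (hδ1 : δ < 1) {η : ℝ} (hη1 : 1 < η) (hη2 : η < (Real.exp 1 / δ) ^ 2)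
    {N : Matrix (Fin d) (Fin d) ℝ → ℝ}
    (hN : ∀ W : Matrix (Fin d) (Fin d) ℝ, 1 ≤ W.det → 1 ≤ DGeneral δ η ell U W →
      c * DGeneral δ η ell U W + √(alphaConst δ η ell / 2 * DGeneral δ η ell U W) +
        maxTerm c (gammaMin U) (DGeneral δ η ell U W) ≤ N W) :
    StoppedBound μ ℱ S V t₀ δ N (fun W => hFactor c U W) := by
  have hδl : 0 < Real.log (1 / δ) := Real.log_pos ((one_lt_div hδ0).2 hδ1)
  have hr : 0 < Real.log η := Real.log_pos hη1
  have hηδ : Real.log η / 2 < 1 + Real.log (1 / δ) := by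
    have := Real.log_lt_log (by linarith) hη2
    rw [Real.log_pow, Real.log_div (Real.exp_pos 1).ne' hδ0.ne', Real.log_exp] at this
    rw [one_div, Real.log_inv]
    push_cast at this
    linarith
  have hl1 := one_le_of_hasSum_inv hell hsum
  set s := max 1 (gammaMax U * (1 + 2 / (c + √(c ^ 2 + 2 * c)))) with hs
  have hs0 : 0 < √s := Real.sqrt_pos.2 (lt_max_of_lt_left one_pos)
  set E := epochLevel δ (Real.log η) (Real.log U.det) ell with hE
  have hE1 : ∀ k, 1 + Real.log (1 / δ) ≤ E k := by
    intro k
    have := Real.log_nonneg (hl1 k)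
    have := le_max_left 0 (k * Real.log η - Real.log U.det)
    rw [hE, epochLevel]
    linarith
  have hE0 : ∀ k, 0 < E k := fun k => by linarith [hE1 k]
  set q : ℕ → ℝ := fun k => √(E k) / √s / (1 + c * (√(E k) / √s)) with hq
  have hq0 : ∀ k, 0 < q k := by
    intro k
    have := Real.sqrt_pos.2 (hE0 k)
    simp only [hq]; positivity
  have hcq : ∀ k, c * q k < 1 := by
    intro k
    have := Real.sqrt_pos.2 (hE0 k)
    have h : c * q k = c * (√(E k) / √s) / (1 + c * (√(E k) / √s)) := mul_div_assoc' _ _ _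
    rw [h, div_lt_one (by positivity)]
    linarith
  obtain ⟨A, hA1, hA2, hA3⟩ := hSV.exists_good_event hc hd hell hsum hq0 hcq hδ0
    (P := fun t ω => (V t ω).PosDef ∧ (t₀ ≤ t → LoewnerGE (V t ω) 1)) (fun t => by
      by_cases ht : t₀ ≤ t
      · filter_upwards [hSV.posDef_V t, hV1 t ht] with ω h1 h2 using ⟨h1, fun _ => h2⟩
      · filter_upwards [hSV.posDef_V t] with ω h1 using ⟨h1, fun h => absurd h ht⟩)
  -- The event controls every fixed time simultaneously, so the stopping time plays no further role.
  refine ⟨A, hA1, hA2, fun τ _ ω hω t _ ht hH => ?_⟩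
  obtain ⟨⟨hV, hV1'⟩, hmix⟩ := hA3 ω hω t
  have hW1 := hV1' ht
  set W := V t ω with hW
  have hv1 : 1 ≤ gammaMin W := hW1.one_le_gammaMin hV.isHermitian hd
  have hdet : 1 ≤ W.det := (one_le_pow₀ hv1).trans (hV.gammaMin_pow_le_det hd)
  have hγ0 : 0 < gammaMax U := (hU.gammaMin_pos hd).trans_le (hU.gammaMin_le_gammaMax hd)
  have hratio : 0 ≤ Real.log (W.det / U.det) := by
    have h1 := gammaMax_lt_gammaMin_of_hFactor_ne_zero (by linarith) hH
    have h2 := Real.log_nonneg ((one_le_div hγ0).2 h1.le)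
    have h3 := mul_log_gammaMin_div_gammaMax_le hd hU hV
    have : (0 : ℝ) ≤ d * Real.log (gammaMin W / gammaMax U) := by positivity
    linarith
  have hdetlog : Real.log (W.det / U.det) = Real.log W.det - Real.log U.det :=
    Real.log_div hV.det_pos.ne' hU.det_pos.ne'
  set k := ⌊Real.logb η W.det⌋₊ with hk
  have hlogb : Real.logb η W.det * Real.log η = Real.log W.det := by
    rw [Real.logb, div_mul_cancel₀ _ hr.ne']
  have hk1 : k * Real.log η ≤ Real.log W.det := by
    rw [← hlogb]
    gcongr
    exact Nat.floor_le (Real.logb_nonneg hη1 hdet)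
  have hk2 : Real.log W.det ≤ (k + 1) * Real.log η := by
    rw [← hlogb]
    gcongr
    exact (Nat.lt_floor_add_one _).le
  set D := DGeneral δ η ell U W with hD
  have hDdef : D = 1 / 2 * Real.log (W.det / U.det) + 1 + Real.log (ell k) + Real.log (1 / δ) := rfl
  have hED : E k ≤ D := by
    -- The truncation at `0` keeps `E k` positive when `det U` exceeds `η^k`. It costs nothing here:
    -- a nonzero `H` makes `det W ≥ det U`.
    have : max 0 (k * Real.log η - Real.log U.det) ≤ Real.log (W.det / U.det) :=
      max_le hratio (by linarith)
    rw [hDdef, hE, epochLevel]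
    linarith
  have hDE : D ≤ E k + Real.log η / 2 := by
    have := le_max_right 0 (k * Real.log η - Real.log U.det)
    rw [hDdef, hE, epochLevel]
    linarith
  have hD1 : 1 ≤ D := by linarith [hE1 k]
  have hsq : √(E k) ^ 2 = E k := Real.sq_sqrt (hE0 k).le
  have hbound := weightedNorm_le_of_lintegral_le hd hc hU hV hW1 (hl1 k) hδ0 hδ1 hH hs hDdef
    (Real.sqrt_pos.2 (hE0 k)) (hsq.trans_le hED) (by rw [hsq]; linarith [hE1 k]) rfl (hmix k)
  have hα : D / √(E k) ≤ √(alphaConst δ η ell / 2 * D) :=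
    div_sqrt_le_sqrt_alphaConst hη1 (one_le_iSup_ratio hell hsum hbdd) (by linarith) (hE1 k) hDE
      (by linarith)
  have hNW := hN W hdet hD1
  have hH0 : 0 ≤ hFactor c U W := le_max_left _ _
  refine hbound.trans ?_
  gcongr
  linarith

theorem hasSum_inv_mul_succ_sq :
    HasSum (fun k : ℕ => (((k : ℝ) + 1) ^ 2 * (Real.pi ^ 2 / 6))⁻¹) 1 := by
  have h := (hasSum_nat_add_iff' 1).2 hasSum_zeta_two
  have h2 := h.mul_left (Real.pi ^ 2 / 6)⁻¹
  have hpi : Real.pi ^ 2 / 6 ≠ 0 := by positivity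
  simp only [Finset.range_one, Finset.sum_singleton, Nat.cast_zero, ne_eq, OfNat.ofNat_ne_zero,
    not_false_eq_true, zero_pow, div_zero, sub_zero, inv_mul_cancel₀ hpi] at h2
  have e : (fun k : ℕ => (((k : ℝ) + 1) ^ 2 * (Real.pi ^ 2 / 6))⁻¹) =
      fun i : ℕ => (Real.pi ^ 2 / 6)⁻¹ * (1 / ((i + 1 : ℕ) : ℝ) ^ 2) := by
    funext k
    push_cast
    rw [mul_inv, mul_comm, one_div]
  rw [e]
  exact h2

theorem succ_sq_ratio_le (k : ℕ) :
    (((k + 2 : ℕ) : ℝ) + 1) ^ 2 * (Real.pi ^ 2 / 6) /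
      ((((k + 1 : ℕ) : ℝ) + 1) ^ 2 * (Real.pi ^ 2 / 6)) ≤ 9 / 4 := by
  rw [mul_div_mul_right _ _ (by positivity), div_le_iff₀ (by positivity)]
  push_cast
  have : (0 : ℝ) ≤ k := k.cast_nonneg
  nlinarith

theorem log_pi_sq_div_six_le : Real.log (Real.pi ^ 2 / 6) ≤ 1 / 2 := by
  rw [Real.log_le_iff_le_exp (by positivity)]
  have h1 : Real.pi ^ 2 ≤ 3.1416 ^ 2 := by
    have := Real.pi_lt_d4
    have := Real.pi_pos
    gcongr
  have h := Real.sum_le_exp_of_nonneg (x := 1 / 2) (by norm_num) 5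
  norm_num [Finset.sum_range_succ, Nat.factorial] at h
  norm_num at h1
  linarith

theorem theorem3 {Ω : Type*} [m : MeasurableSpace Ω] (μ : Measure Ω) [IsProbabilityMeasure μ]
    (ℱ : Filtration ℕ m) (d : ℕ) (hd : 0 < d) (c : ℝ) (hc : 0 < c)
    (S : ℕ → Ω → EuclideanSpace ℝ (Fin d)) (V : ℕ → Ω → Matrix (Fin d) (Fin d) ℝ)
    (hSV : IsSubGamma μ ℱ c S V)
    (U₀ : Matrix (Fin d) (Fin d) ℝ) (hU₀ : U₀.PosDef) (t₀ : ℕ)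
    (hVU : ∀ t, t₀ ≤ t → ∀ᵐ ω ∂μ, LoewnerGE (V t ω) U₀) :
    -- the simplified bound
    (LoewnerGE U₀ 1 → ∀ δ : ℝ, 0 < δ → δ ≤ 1 / Real.sqrt 2 →
      StoppedBound μ ℱ S V t₀ δ
        (fun W => c * DSimple δ U₀ W + 1.60 * Real.sqrt (DSimple δ U₀ W) +
          maxTerm c (gammaMin U₀) (DSimple δ U₀ W))
        (fun W => hFactor c U₀ W)) ∧
    -- the general form
    ((∀ t, t₀ ≤ t → ∀ᵐ ω ∂μ, LoewnerGE (V t ω) 1) →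
      ∀ ell : ℕ → ℝ, (∀ k, 0 < ell k) → HasSum (fun k => (ell k)⁻¹) 1 →
      BddAbove (Set.range fun k : ℕ => ell (k + 2) / ell (k + 1)) →
      ∀ δ : ℝ, 0 < δ → δ < 1 → ∀ η : ℝ, 1 < η → η < (Real.exp 1 / δ) ^ 2 →
      StoppedBound μ ℱ S V t₀ δ
        (fun W => c * DGeneral δ η ell U₀ W +
          Real.sqrt (alphaConst δ η ell / 2 * DGeneral δ η ell U₀ W) +
          maxTerm c (gammaMin U₀) (DGeneral δ η ell U₀ W))
        (fun W => hFactor c U₀ W)) := by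
  refine ⟨fun hU1 δ hδ0 hδ2 => ?_, fun hV1 ell hell hsum hbdd δ hδ0 hδ1 η hη1 hη2 =>
    stoppedBound_of_general_le hd hc hSV hU₀ hV1 hell hsum hbdd hδ0 hδ1 hη1 hη2
      fun _ _ _ => le_rfl⟩
  have hl2 := Real.log_two_lt_d9
  have hl3 := Real.log_two_gt_d9
  have hδl : Real.log 2 / 2 ≤ Real.log (1 / δ) := by
    rw [← Real.log_sqrt (by norm_num)]
    refine Real.log_le_log (by positivity) ?_
    rwa [le_one_div (by positivity) hδ0]
  have hδ1 : δ < 1 := by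
    refine hδ2.trans_lt ((div_lt_one (by positivity)).2 ?_)
    rw [Real.lt_sqrt (by norm_num)]; norm_num
  set ell : ℕ → ℝ := fun k => ((k : ℝ) + 1) ^ 2 * (Real.pi ^ 2 / 6) with hell
  have hell0 : ∀ k, 0 < ell k := fun k => by simp only [hell]; positivity
  have hratio : ∀ k : ℕ, ell (k + 2) / ell (k + 1) ≤ 9 / 4 := succ_sq_ratio_le
  have hη2 : (2 : ℝ) < (Real.exp 1 / δ) ^ 2 := by
    have h1 : (2 : ℝ) ≤ Real.exp 1 := by have := Real.add_one_le_exp 1; linarith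
    have h2 : Real.exp 1 ≤ Real.exp 1 / δ := le_div_self (Real.exp_pos 1).le hδ0 hδ1.le
    nlinarith
  refine stoppedBound_of_general_le hd hc hSV hU₀ (ell := ell) (η := 2) ?_ hell0
    hasSum_inv_mul_succ_sq ⟨9 / 4, by rintro _ ⟨k, rfl⟩; exact hratio k⟩ hδ0 hδ1 one_lt_two hη2 ?_
  · intro t ht
    filter_upwards [hVU t ht] with ω hω using hω.trans hU1
  intro W hW hD1
  have hlogb : 0 ≤ Real.logb 2 W.det := Real.logb_nonneg one_lt_two hW
  have hDle : DGeneral δ 2 ell U₀ W ≤ DSimple δ U₀ W := by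
    have h1 : Real.log (ell ⌊Real.logb 2 W.det⌋₊) ≤ 2 * Real.log (Real.logb 2 W.det + 1) + 1 / 2 := by
      have h2 := Nat.floor_le hlogb
      have h3 := log_pi_sq_div_six_le
      simp only [hell]
      rw [Real.log_mul (by positivity) (by positivity), Real.log_pow]
      push_cast
      gcongr
    rw [DGeneral, DSimple]
    linarith
  -- The condition `δ ≤ 1/√2` makes the denominator in `α` at least `1`, so `α ≤ 1 + log 2 + 9/4 <
  -- 3.95`, and `3.95/2 ≤ 1.60²`.
  have hα : alphaConst δ 2 ell ≤ 3.95 := by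
    have h1 : ⨆ k : ℕ, ell (k + 2) / ell (k + 1) ≤ 9 / 4 := ciSup_le hratio
    have h2 : Real.log 2 / (1 + Real.log (1 / δ) - Real.log 2 / 2) ≤ Real.log 2 :=
      div_le_self (by linarith) (by linarith)
    rw [alphaConst]
    linarith
  have hsqrt : √(alphaConst δ 2 ell / 2 * DGeneral δ 2 ell U₀ W) ≤ 1.60 * √(DSimple δ U₀ W) := by
    refine Real.sqrt_le_iff.2 ⟨by positivity, ?_⟩
    rw [mul_pow, Real.sq_sqrt (by linarith)]
    nlinarith
  have hmax : maxTerm c (gammaMin U₀) (DGeneral δ 2 ell U₀ W) ≤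
      maxTerm c (gammaMin U₀) (DSimple δ U₀ W) :=
    max_le_max le_rfl (Real.sqrt_le_sqrt (by linarith))
  gcongr
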